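/- Let $\mathscr H=L^2((0,1),\mathbb R)\oplus L^2((0,1),\mathbb R)$ with its usual inner product, and for $f,g\in\mathscr H$ put $f\wedge g=\int_0^1\big(f_1(x)g_2(x)-f_2(x)g_1(x)\big)\,dx$. For $v=(v_1,v_2)\in\mathscr H$ consider on $[0,1]$ the Zakharov--Shabat system $$Jf'+Vf=\lambda f,\qquad J=\begin{pmatrix}0&1\\-1&0\end{pmatrix},\quad V=\begin{pmatrix}v_1&v_2\\v_2&-v_1\end{pmatrix},\quad \lambda\in\mathbb C,$$ and let $\vartheta=(\vartheta_1,\vartheta_2)^\top$, $\varphi=(\varphi_1,\varphi_2)^\top$ be its solutions with $\vartheta(0,\lambda)=(1,0)^\top$, $\varphi(0,\lambda)=(0,1)^\top$. Let $\nu_n(v)$, $\tau_n(v)$, $\varrho_n(v)$, $n\in\mathbb Z$, be the eigenvalues of the system under the boundary conditions $f_2(0)=f_2(1)=0$, $f_1(0)=f_2(1)=0$ and $f_2(0)=f_1(1)=0$ respectively; they are real and are labelled in strictly increasing order so that $\nu_n=\pi n+o(1)$ and $\tau_n,\varrho_n=\pi(n-\tfrac12)+o(1)$ as $n\to\pm\infty$.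 Define the norming constants $$\mathfrak s_n=-\log|\vartheta_1(1,\nu_n)|,\qquad \mathfrak t_n=-\log|\varphi_1(1,\tau_n)|,\qquad \mathfrak u_n=-\log|\vartheta_2(1,\varrho_n)|.$$ Then all these functions of $v$ are differentiable on $\mathscr H$, and, writing $'$ for the gradient with respect to $v$ in $\mathscr H$, for all $v\in\mathscr H$ and $n,j\in\mathbb Z$: $$\begin{aligned} \nu_n'\wedge\nu_j'&=0,&\mathfrak s_n'\wedge\nu_j'&=\delta_{nj},&\mathfrak s_n'\wedge\mathfrak s_j'&=0,\\ \tau_n'\wedge\tau_j'&=0,&\mathfrak t_n'\wedge\tau_j'&=\delta_{nj},&\mathfrak t_n'\wedge\mathfrak t_j'&=0,\\ \varrho_n'\wedge\varrho_j'&=0,&\mathfrak u_n'\wedge\varrho_j'&=\delta_{nj},&\mathfrak u_n'\wedge\mathfrak u_j'&=0. \end{aligned}$$ Moreover, for each $v\in\mathscr H$, each of the three families $\{\nu_n'(v),\mathfrak s_n'(v)\}_{n\in\mathbb Z}$, $\{\tau_n'(v),\mathfrak t_n'(v)\}_{n\in\mathbb Z}$, $\{\varrho_n'(v),\mathfrak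 u_n'(v)\}_{n\in\mathbb Z}$ is a (Riesz) basis of $\mathscr H$: the map sending square-summable coefficients to the corresponding linear combination of the family is a linear homeomorphism of $\ell^2$ onto $\mathscr H$. -/

import Mathlib

open MeasureTheory

noncomputable section

namespace ZS

/-- Lebesgue measure on the unit interval `(0,1)`. -/
abbrev unitMeasure : Measure ℝ := volume.restrict (Set.Ioo (0 : ℝ) 1)

/-- The real Hilbert space `𝓗 = L²((0,1),ℝ) ⊕ L²((0,1),ℝ)`. -/
abbrev H : Type := WithLp 2 (Lp ℝ 2 unitMeasure × Lp ℝ 2 unitMeasure)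

/-- The symplectic form `f ∧ g = ∫₀¹ (f₁ g₂ - f₂ g₁) dx`. -/
def wedge (f g : H) : ℝ :=
  ∫ x, (f.fst x * g.snd x - f.snd x * g.fst x) ∂unitMeasure

/-- The matrix `J`. -/
def J : Matrix (Fin 2) (Fin 2) ℂ := !![0, 1; -1, 0]

/-- The matrix potential `V` built from `v = (v₁, v₂)`. -/
def V (v : H) (x : ℝ) : Matrix (Fin 2) (Fin 2) ℂ :=
  !![(v.fst x : ℂ), (v.snd x : ℂ); (v.snd x : ℂ), -(v.fst x : ℂ)]

/-- `f` is an (absolutely continuous) solution on `[0,1]` of `J f' + V f = l f`.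
Since `J² = -1`, the equation is `f' = J (V - l) f`, and it is written in integrated form. -/
def IsSolution (v : H) (l : ℂ) (f : ℝ → Fin 2 → ℂ) : Prop :=
  ContinuousOn f (Set.Icc 0 1) ∧
  ∀ x ∈ Set.Icc (0 : ℝ) 1,
    f x = f 0 + ∫ t in (0 : ℝ)..x, (J * (V v t - l • (1 : Matrix (Fin 2) (Fin 2) ℂ))).mulVec (f t)

/-- The solution with initial value `a` at `0`; it is unique on `[0,1]`, and its values elsewhere
are irrelevant. -/
def solution (v : H) (l : ℂ) (a : Fin 2 → ℂ) : ℝ → Fin 2 → ℂ :=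
  Classical.epsilon fun f => IsSolution v l f ∧ f 0 = a

/-- The fundamental solution `ϑ(x, l)` with `ϑ(0, l) = (1, 0)`. -/
def theta (v : H) (l : ℂ) : ℝ → Fin 2 → ℂ := solution v l ![1, 0]

/-- The fundamental solution `φ(x, l)` with `φ(0, l) = (0, 1)`. -/
def phi (v : H) (l : ℂ) : ℝ → Fin 2 → ℂ := solution v l ![0, 1]

/-- The eigenvalues of `J f' + V f = l f` under the boundary conditions `f_i(0) = f_k(1) = 0`
(the components are numbered `0, 1` here). -/
def eigenvalues (v : H) (i k : Fin 2) : Set ℂ :=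
  {l | ∃ f : ℝ → Fin 2 → ℂ, IsSolution v l f ∧ (∃ x ∈ Set.Icc (0 : ℝ) 1, f x ≠ 0) ∧
    f 0 i = 0 ∧ f 1 k = 0}

/-- `s` is the strictly increasing enumeration by `ℤ` of the set `S`, labelled so that
`s n = c n + o(1)` as `n → ±∞`. There is at most one such `s`. -/
def IsLabelling (S : Set ℂ) (c : ℤ → ℝ) (s : ℤ → ℝ) : Prop :=
  StrictMono s ∧ Set.range (fun n => (s n : ℂ)) = S ∧
    Filter.Tendsto (fun n => s n - c n) Filter.cofinite (nhds 0)

/-- Neumann eigenvalues `ν_n`: `f₂(0) = f₂(1) = 0`, `ν_n = π n + o(1)`. -/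
def nu (n : ℤ) (v : H) : ℝ :=
  Classical.epsilon (IsLabelling (eigenvalues v 1 1) fun m => Real.pi * m) n

/-- Mixed eigenvalues of the first type `τ_n`: `f₁(0) = f₂(1) = 0`, `τ_n = π (n - 1/2) + o(1)`. -/
def tau (n : ℤ) (v : H) : ℝ :=
  Classical.epsilon (IsLabelling (eigenvalues v 0 1) fun m => Real.pi * (m - 1 / 2)) n

/-- Mixed eigenvalues of the second type `ϱ_n`: `f₂(0) = f₁(1) = 0`, `ϱ_n = π (n - 1/2) + o(1)`. -/
def rho (n : ℤ) (v : H) : ℝ :=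
  Classical.epsilon (IsLabelling (eigenvalues v 1 0) fun m => Real.pi * (m - 1 / 2)) n

/-- Norming constants `𝔰_n = -log |ϑ₁(1, ν_n)|`. -/
def normS (n : ℤ) (v : H) : ℝ := -Real.log ‖theta v (nu n v) 1 0‖

/-- Norming constants `𝔱_n = -log |φ₁(1, τ_n)|`. -/
def normT (n : ℤ) (v : H) : ℝ := -Real.log ‖phi v (tau n v) 1 0‖

/-- Norming constants `𝔲_n = -log |ϑ₂(1, ϱ_n)|`. -/
def normU (n : ℤ) (v : H) : ℝ := -Real.log ‖theta v (rho n v) 1 1‖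

/-- `e` is a basis of `𝓗`: the map `a ↦ ∑ a_i e_i` is a linear homeomorphism of `ℓ²` onto `𝓗`. -/
def IsBasis {ι : Type} [DecidableEq ι] (e : ι → H) : Prop :=
  ∃ T : lp (fun _ : ι => ℝ) 2 ≃L[ℝ] H, ∀ i, T (lp.single 2 i (1 : ℝ)) = e i

end ZS

end

/-!
For real `l` the system is the single equation `z' = i l z - i v z̄` for `z = f₁ + i f₂`. Its
solution `z` with `z(0) = 1` never vanishes, and the continuous choice of `arg z(1)` is strictly
increasing in `l`, so the eigenvalues are the level sets of this angle on a translate of `π ℤ`, and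
the norming constants are the values of `-log |z(1)|` there. The implicit function theorem expresses
the gradients of both through products of two solutions. For two such products `F` and `G` the
integrand of `F ∧ G` is, up to the factor `λₙ - λⱼ`, the derivative of a product of Wronskians,
which gives the canonical relations. Finally the gradients are quadratically close to their values
at `v = 0`, a Fourier basis of `𝓗`, so synthesis along them is a compact perturbation of an
isomorphism; it is injective by the canonical relations, hence an isomorphism by the Fredholm
alternative. The boundary conditions defining `τₙ` and `ϱₙ` are exchanged by `v ↦ -v`.
-/

noncomputable section

namespace ZS

open Set Filter Topology
open scoped ComplexConjugate BoundedContinuousFunction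

/-! ### Primitives of integrable functions on the unit interval -/

section Primitive

theorem integrable_unitMeasure_iff {E : Type*} [NormedAddCommGroup E] {g : ℝ → E} :
    Integrable g unitMeasure ↔ IntervalIntegrable g volume 0 1 :=
  (intervalIntegrable_iff_integrableOn_Ioo_of_le zero_le_one).symm

theorem intervalIntegrable_of_mem_Icc {E : Type*} [NormedAddCommGroup E] {g : ℝ → E}
    (hg : Integrable g unitMeasure) {x : ℝ} (hx : x ∈ Icc (0 : ℝ) 1) :
    IntervalIntegrable g volume 0 x :=
  (integrable_unitMeasure_iff.1 hg).mono_set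
    (uIcc_subset_uIcc left_mem_uIcc (by rwa [uIcc_of_le zero_le_one]))

variable {E F : Type*} [NormedAddCommGroup E] [NormedSpace ℝ E] [NormedAddCommGroup F]
  [NormedSpace ℝ F]

theorem absolutelyContinuousOnInterval_of_dist_le {Y Z : Type*} [PseudoMetricSpace Y]
    [PseudoMetricSpace Z] {f : ℝ → Y} {g : ℝ → Z} {a b K : ℝ} (hK : 0 ≤ K)
    (hf : AbsolutelyContinuousOnInterval f a b)
    (h : ∀ x ∈ uIcc a b, ∀ y ∈ uIcc a b, dist (g x) (g y) ≤ K * dist (f x) (f y)) :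
    AbsolutelyContinuousOnInterval g a b := by
  rw [absolutelyContinuousOnInterval_iff] at hf ⊢
  intro ε hε
  obtain ⟨δ, hδ, hfδ⟩ := hf (ε / (K + 1)) (by positivity)
  refine ⟨δ, hδ, fun I hI hlt => ?_⟩
  calc ∑ i ∈ Finset.range I.1, dist (g (I.2 i).1) (g (I.2 i).2)
      ≤ ∑ i ∈ Finset.range I.1, K * dist (f (I.2 i).1) (f (I.2 i).2) :=
        Finset.sum_le_sum fun i hi => h _ (hI.1 i hi).1 _ (hI.1 i hi).2
    _ = K * ∑ i ∈ Finset.range I.1, dist (f (I.2 i).1) (f (I.2 i).2) := by rw [Finset.mul_sum]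
    _ ≤ K * (ε / (K + 1)) := by gcongr; exact (hfδ I hI hlt).le
    _ < (K + 1) * (ε / (K + 1)) := by gcongr; linarith
    _ = ε := by field

theorem absolutelyContinuousOnInterval_integral {g : ℝ → E} {a b c : ℝ}
    (hg : IntervalIntegrable g volume a b) (hc : c ∈ uIcc a b) :
    AbsolutelyContinuousOnInterval (fun x => ∫ t in c..x, g t) a b := by
  refine absolutelyContinuousOnInterval_of_dist_le zero_le_one
    (hg.norm.absolutelyContinuousOnInterval_intervalIntegral hc) fun x hx y hy => ?_
  have hint {z : ℝ} (hz : z ∈ uIcc a b) : IntervalIntegrable g volume c z :=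
    hg.mono_set (uIcc_subset_uIcc hc hz)
  rw [one_mul, dist_eq_norm, dist_eq_norm,
    intervalIntegral.integral_interval_sub_left (hint hx) (hint hy),
    intervalIntegral.integral_interval_sub_left (hint hx).norm (hint hy).norm]
  exact intervalIntegral.norm_integral_le_abs_integral_norm

theorem integral_unitMeasure (g : ℝ → E) : ∫ t, g t ∂unitMeasure = ∫ t in (0 : ℝ)..1, g t := by
  rw [intervalIntegral.integral_of_le zero_le_one, integral_Ioc_eq_integral_Ioo]

theorem integrable_unitMeasure_mul_continuousOn {𝔸 : Type*} [NormedRing 𝔸] {g f : ℝ → 𝔸}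
    (hg : Integrable g unitMeasure) (hf : ContinuousOn f (Icc 0 1)) :
    Integrable (fun t => g t * f t) unitMeasure :=
  integrable_unitMeasure_iff.2 <| (integrable_unitMeasure_iff.1 hg).mul_continuousOn
    (by rwa [uIcc_of_le zero_le_one])

theorem intervalIntegral_congr_ae_unitMeasure {g₁ g₂ : ℝ → E} (h : g₁ =ᵐ[unitMeasure] g₂) {x : ℝ}
    (hx : x ∈ Icc (0 : ℝ) 1) : ∫ t in (0 : ℝ)..x, g₁ t = ∫ t in (0 : ℝ)..x, g₂ t := by
  refine intervalIntegral.integral_congr_ae ?_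
  filter_upwards [(ae_restrict_iff' measurableSet_Ioo).1 h, Measure.ae_ne volume (1 : ℝ)]
    with t ht ht1 hmem
  rw [uIoc_of_le hx.1] at hmem
  exact ht ⟨hmem.1, lt_of_le_of_ne (hmem.2.trans hx.2) ht1⟩

theorem norm_intervalIntegral_le_integral_norm {g : ℝ → E} (hg : Integrable g unitMeasure) {x : ℝ}
    (hx : x ∈ Icc (0 : ℝ) 1) : ‖∫ t in (0 : ℝ)..x, g t‖ ≤ ∫ t, ‖g t‖ ∂unitMeasure := by
  refine (intervalIntegral.norm_integral_le_integral_norm hx.1).trans ?_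
  rw [integral_unitMeasure]
  exact intervalIntegral.integral_mono_interval le_rfl hx.1 hx.2
    (Eventually.of_forall fun _ => norm_nonneg _) (integrable_unitMeasure_iff.1 hg.norm)

/-- `f` is, on `[0,1]`, a primitive of the integrable function `g`; equivalently, `f` is absolutely
continuous there with `f' = g` almost everywhere. -/
structure IsPrimitive (f g : ℝ → E) : Prop where
  integrable : Integrable g unitMeasure
  eq_add_integral : ∀ x ∈ Icc (0 : ℝ) 1, f x = f 0 + ∫ t in (0 : ℝ)..x, g t

namespace IsPrimitive

variable {f g f₁ g₁ f₂ g₂ : ℝ → E}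

theorem integral (hg : Integrable g unitMeasure) :
    IsPrimitive (fun x => ∫ t in (0 : ℝ)..x, g t) g :=
  ⟨hg, by simp⟩

theorem const (c : E) : IsPrimitive (fun _ => c) (fun _ => 0) := ⟨by simp, by simp⟩

theorem ofReal : IsPrimitive (fun x => (x : ℂ)) (fun _ => 1) := ⟨by simp, fun x _ => by simp⟩

theorem congr (h : IsPrimitive f g) (hf : EqOn f₁ f (Icc 0 1)) (hg : g₁ =ᵐ[unitMeasure] g) :
    IsPrimitive f₁ g₁ := by
  refine ⟨h.integrable.congr hg.symm, fun x hx => ?_⟩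
  rw [hf hx, hf (left_mem_Icc.2 zero_le_one), h.eq_add_integral x hx,
    intervalIntegral_congr_ae_unitMeasure hg hx]

theorem add (h₁ : IsPrimitive f₁ g₁) (h₂ : IsPrimitive f₂ g₂) :
    IsPrimitive (fun x => f₁ x + f₂ x) (fun x => g₁ x + g₂ x) := by
  refine ⟨h₁.integrable.add h₂.integrable, fun x hx => ?_⟩
  rw [intervalIntegral.integral_add (intervalIntegrable_of_mem_Icc h₁.integrable hx)
    (intervalIntegrable_of_mem_Icc h₂.integrable hx), h₁.eq_add_integral x hx,
    h₂.eq_add_integral x hx]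
  abel

theorem sub (h₁ : IsPrimitive f₁ g₁) (h₂ : IsPrimitive f₂ g₂) :
    IsPrimitive (fun x => f₁ x - f₂ x) (fun x => g₁ x - g₂ x) := by
  refine ⟨h₁.integrable.sub h₂.integrable, fun x hx => ?_⟩
  rw [intervalIntegral.integral_sub (intervalIntegrable_of_mem_Icc h₁.integrable hx)
    (intervalIntegrable_of_mem_Icc h₂.integrable hx), h₁.eq_add_integral x hx,
    h₂.eq_add_integral x hx]
  abel

theorem clm_comp [CompleteSpace E] [CompleteSpace F] (L : E →L[ℝ] F) (h : IsPrimitive f g) :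
    IsPrimitive (fun x => L (f x)) (fun x => L (g x)) := by
  refine ⟨L.integrable_comp h.integrable, fun x hx => ?_⟩
  rw [L.intervalIntegral_comp_comm (intervalIntegrable_of_mem_Icc h.integrable hx),
    h.eq_add_integral x hx, map_add]

theorem pi_iff {ι : Type*} [Fintype ι] {f g : ℝ → ι → ℂ} :
    IsPrimitive f g ↔ ∀ i, IsPrimitive (fun x => f x i) (fun x => g x i) := by
  refine ⟨fun h i => h.clm_comp (ContinuousLinearMap.proj (R := ℝ) (φ := fun _ : ι => ℂ) i),
    fun h => ?_⟩
  have hg : Integrable g unitMeasure := Integrable.of_eval fun i => (h i).integrable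
  refine ⟨hg, fun x hx => funext fun i => ?_⟩
  rw [(h i).eq_add_integral x hx, Pi.add_apply]
  congr 1
  exact (ContinuousLinearMap.proj (R := ℝ) (φ := fun _ : ι => ℂ) i).intervalIntegral_comp_comm
    (intervalIntegrable_of_mem_Icc hg hx)

theorem apply_one (h : IsPrimitive f g) : f 1 = f 0 + ∫ t, g t ∂unitMeasure := by
  rw [h.eq_add_integral 1 (right_mem_Icc.2 zero_le_one), integral_unitMeasure]

theorem eq_apply_zero (h : IsPrimitive f g) (hg : g =ᵐ[unitMeasure] 0) {x : ℝ}
    (hx : x ∈ Icc (0 : ℝ) 1) : f x = f 0 := by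
  simpa using (h.congr (eqOn_refl f _) hg.symm).eq_add_integral x hx

theorem norm_sub_le (h : IsPrimitive f g) {x : ℝ} (hx : x ∈ Icc (0 : ℝ) 1) :
    ‖f x - f 0‖ ≤ ∫ t, ‖g t‖ ∂unitMeasure := by
  rw [h.eq_add_integral x hx, add_sub_cancel_left]
  exact norm_intervalIntegral_le_integral_norm h.integrable hx

theorem absolutelyContinuous (h : IsPrimitive f g) : AbsolutelyContinuousOnInterval f 0 1 := by
  refine absolutelyContinuousOnInterval_of_dist_le zero_le_one
    (absolutelyContinuousOnInterval_integral (integrable_unitMeasure_iff.1 h.integrable)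
      left_mem_uIcc) fun x hx y hy => ?_
  rw [uIcc_of_le zero_le_one] at hx hy
  rw [h.eq_add_integral x hx, h.eq_add_integral y hy, dist_add_left, one_mul]

theorem continuousOn (h : IsPrimitive f g) : ContinuousOn f (Icc 0 1) := by
  simpa only [uIcc_of_le zero_le_one] using h.absolutelyContinuous.continuousOn

theorem ae_hasDerivAt [CompleteSpace E] (h : IsPrimitive f g) :
    ∀ᵐ x, x ∈ uIcc (0 : ℝ) 1 → HasDerivAt f (g x) x := by
  filter_upwards [(integrable_unitMeasure_iff.1 h.integrable).ae_hasDerivAt_integral,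
    Measure.ae_ne volume (0 : ℝ), Measure.ae_ne volume (1 : ℝ)] with x hderiv hx0 hx1 hx
  have hIcc : x ∈ Icc (0 : ℝ) 1 := by rwa [uIcc_of_le zero_le_one] at hx
  refine ((hderiv hx 0 left_mem_uIcc).const_add (f 0)).congr_of_eventuallyEq ?_
  filter_upwards [Icc_mem_nhds (hIcc.1.lt_of_ne' hx0) (hIcc.2.lt_of_ne hx1)] with y hy
  exact h.eq_add_integral y hy

theorem of_ae_hasDerivAt [CompleteSpace E] (hf : AbsolutelyContinuousOnInterval f 0 1)
    (hg : Integrable g unitMeasure) (h : ∀ᵐ x, x ∈ uIcc (0 : ℝ) 1 → HasDerivAt f (g x) x) :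
    IsPrimitive f g := by
  have hint := integrable_unitMeasure_iff.1 hg
  have hsub := hf.sub (absolutelyContinuousOnInterval_integral hint left_mem_uIcc)
  obtain ⟨C, hC⟩ := hsub.const_of_ae_hasDerivAt_zero <| by
    filter_upwards [h, hint.ae_hasDerivAt_integral] with x h₁ h₂ hx
    simpa using (h₁ hx).sub (h₂ hx 0 left_mem_uIcc)
  refine ⟨hg, fun x hx => ?_⟩
  have h0 : f 0 = C := by simpa using hC 0 left_mem_uIcc
  rw [h0, ← hC x (by rwa [uIcc_of_le zero_le_one])]
  simp

theorem mul {𝕜 : Type*} [RCLike 𝕜] {f₁ g₁ f₂ g₂ : ℝ → 𝕜} (h₁ : IsPrimitive f₁ g₁)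
    (h₂ : IsPrimitive f₂ g₂) :
    IsPrimitive (fun x => f₁ x * f₂ x) (fun x => g₁ x * f₂ x + f₁ x * g₂ x) := by
  refine of_ae_hasDerivAt (h₁.absolutelyContinuous.smul h₂.absolutelyContinuous) ?_ ?_
  · refine (integrable_unitMeasure_mul_continuousOn h₁.integrable h₂.continuousOn).add ?_
    simpa only [mul_comm] using
      integrable_unitMeasure_mul_continuousOn h₂.integrable h₁.continuousOn
  · filter_upwards [h₁.ae_hasDerivAt, h₂.ae_hasDerivAt] with x hx₁ hx₂ hx
    exact (hx₁ hx).mul (hx₂ hx)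

theorem const_mul {f g : ℝ → ℂ} (c : ℂ) (h : IsPrimitive f g) :
    IsPrimitive (fun x => c * f x) (fun x => c * g x) :=
  h.clm_comp ((ContinuousLinearMap.mul ℝ ℂ) c)

theorem conjugate {f g : ℝ → ℂ} (h : IsPrimitive f g) :
    IsPrimitive (fun x => conj (f x)) (fun x => conj (g x)) :=
  h.clm_comp Complex.conjCLE.toContinuousLinearMap

theorem cexp {f g : ℝ → ℂ} (h : IsPrimitive f g) :
    IsPrimitive (fun x => Complex.exp (f x)) (fun x => g x * Complex.exp (f x)) := by
  have hcompact : IsCompact (f '' Icc 0 1) := isCompact_Icc.image_of_continuousOn h.continuousOn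
  obtain ⟨R, hR⟩ := hcompact.isBounded.subset_closedBall 0
  have hexp : ContDiff ℝ 1 Complex.exp := (Complex.contDiff_exp (𝕜 := ℂ)).restrict_scalars ℝ
  obtain ⟨K, hK⟩ := hexp.contDiffOn.exists_lipschitzOnWith (by decide)
    (convex_closedBall (0 : ℂ) R) (isCompact_closedBall (0 : ℂ) R)
  have hball {x : ℝ} (hx : x ∈ uIcc (0 : ℝ) 1) : f x ∈ Metric.closedBall 0 R :=
    hR ⟨x, by rwa [uIcc_of_le zero_le_one] at hx, rfl⟩
  refine of_ae_hasDerivAt (absolutelyContinuousOnInterval_of_dist_le K.2 h.absolutelyContinuous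
    fun x hx y hy => hK.dist_le_mul _ (hball hx) _ (hball hy)) ?_ ?_
  · exact integrable_unitMeasure_mul_continuousOn h.integrable
      (Complex.continuous_exp.comp_continuousOn h.continuousOn)
  · filter_upwards [h.ae_hasDerivAt] with x hderiv hx
    simpa only [mul_comm] using (hderiv hx).cexp

end IsPrimitive

end Primitive

/-! ### The complex potential -/

section Potential

/-- The complex potential `v₁ + i v₂`, through which the system for `f` becomes the single equation
`z' = i l z - i v z̄` for `z = f₁ + i f₂` when `l` is real. -/
def pot (v : H) (t : ℝ) : ℂ := (v.fst t : ℂ) + (v.snd t : ℂ) * Complex.I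

theorem pot_re (v : H) (t : ℝ) : (pot v t).re = v.fst t := by simp [pot]

theorem pot_im (v : H) (t : ℝ) : (pot v t).im = v.snd t := by simp [pot]

instance : IsProbabilityMeasure unitMeasure := ⟨by simp [unitMeasure]⟩

theorem memLp_pot (v : H) : MemLp (pot v) 2 unitMeasure :=
  ((Lp.memLp v.fst).ofReal (K := ℂ)).add (((Lp.memLp v.snd).ofReal (K := ℂ)).mul_const Complex.I)

theorem integrable_pot (v : H) : Integrable (pot v) unitMeasure :=
  (memLp_pot v).integrable (by norm_num)

theorem pot_add (v w : H) : pot (v + w) =ᵐ[unitMeasure] fun t => pot v t + pot w t := by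
  filter_upwards [Lp.coeFn_add v.fst w.fst, Lp.coeFn_add v.snd w.snd] with t hfst hsnd
  simp only [pot, WithLp.add_fst, WithLp.add_snd, hfst, hsnd, Pi.add_apply]
  push_cast; ring

theorem pot_smul (r : ℝ) (v : H) : pot (r • v) =ᵐ[unitMeasure] fun t => (r : ℂ) * pot v t := by
  filter_upwards [Lp.coeFn_smul r v.fst, Lp.coeFn_smul r v.snd] with t hfst hsnd
  simp only [pot, WithLp.smul_fst, WithLp.smul_snd, hfst, hsnd, Pi.smul_apply, smul_eq_mul]
  push_cast; ring

theorem pot_neg (v : H) : pot (-v) =ᵐ[unitMeasure] fun t => -pot v t := by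
  filter_upwards [pot_smul (-1) v] with t h
  simpa using h

theorem inner_eq_integral (u v : H) :
    inner ℝ u v = ∫ t, (conj (pot u t) * pot v t).re ∂unitMeasure := by
  rw [WithLp.prod_inner_apply, L2.inner_def, L2.inner_def,
    ← integral_add (L2.integrable_inner _ _) (L2.integrable_inner _ _)]
  refine integral_congr_ae (Eventually.of_forall fun t => ?_)
  simp [pot]; ring

theorem wedge_eq_integral (u v : H) :
    wedge u v = ∫ t, (conj (pot u t) * pot v t).im ∂unitMeasure := by
  refine integral_congr_ae (Eventually.of_forall fun t => ?_)
  simp [pot]; ring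

theorem norm_sq_eq_integral (v : H) : ‖v‖ ^ 2 = ∫ t, ‖pot v t‖ ^ 2 ∂unitMeasure := by
  rw [← real_inner_self_eq_norm_sq, inner_eq_integral]
  refine integral_congr_ae (Eventually.of_forall fun t => ?_)
  simp only [Complex.conj_mul']
  norm_cast

theorem integral_norm_mul_norm_le {α E F : Type*} [MeasurableSpace α] {μ : Measure α}
    [NormedAddCommGroup E] [NormedAddCommGroup F] {f : α → E} {g : α → F} (hf : MemLp f 2 μ)
    (hg : MemLp g 2 μ) :
    ∫ t, ‖f t‖ * ‖g t‖ ∂μ ≤ √(∫ t, ‖f t‖ ^ 2 ∂μ) * √(∫ t, ‖g t‖ ^ 2 ∂μ) := by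
  have h := integral_mul_norm_le_Lp_mul_Lq (μ := μ) (p := 2) (q := 2)
    (f := fun t => ‖f t‖) (g := fun t => ‖g t‖)
    (Real.holderConjugate_iff.2 ⟨by norm_num, by norm_num⟩)
    (by simpa using hf.norm) (by simpa using hg.norm)
  simpa only [norm_norm, Real.rpow_two, ← Real.sqrt_eq_rpow] using h

theorem integral_norm_pot_mul_le (v : H) {g : ℝ → ℂ} (hg : MemLp g 2 unitMeasure) :
    ∫ t, ‖pot v t‖ * ‖g t‖ ∂unitMeasure ≤ ‖v‖ * √(∫ t, ‖g t‖ ^ 2 ∂unitMeasure) := by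
  simpa only [← norm_sq_eq_integral, Real.sqrt_sq (norm_nonneg v)] using
    integral_norm_mul_norm_le (memLp_pot v) hg

theorem integral_norm_pot_le (v : H) : ∫ t, ‖pot v t‖ ∂unitMeasure ≤ ‖v‖ := by
  simpa using integral_norm_pot_mul_le v (memLp_const (1 : ℂ))

end Potential

/-! ### The Volterra operator of the system -/

section Volterra

/-- The retraction of `ℝ` onto `[0,1]`. Functions on `[0,1]` are extended to `ℝ` by composition with
it, so that solutions can be sought in the Banach algebra `ℝ →ᵇ ℂ`. -/
def clamp (x : ℝ) : ℝ := projIcc 0 1 zero_le_one x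

theorem clamp_mem (x : ℝ) : clamp x ∈ Icc (0 : ℝ) 1 := Subtype.property _

theorem clamp_of_mem {x : ℝ} (hx : x ∈ Icc (0 : ℝ) 1) : clamp x = x := by
  rw [clamp, projIcc_of_mem zero_le_one hx]

theorem clamp_zero : clamp 0 = 0 := clamp_of_mem (left_mem_Icc.2 zero_le_one)

theorem continuous_clamp : Continuous clamp := continuous_subtype_val.comp continuous_projIcc

theorem memLp_boundedContinuousFunction (z : ℝ →ᵇ ℂ) : MemLp z 2 unitMeasure :=
  MemLp.of_bound z.continuous.aestronglyMeasurable ‖z‖ (Eventually.of_forall z.norm_coe_le_norm)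

theorem integrable_mul_boundedContinuousFunction {g : ℝ → ℂ} (hg : Integrable g unitMeasure)
    (z : ℝ →ᵇ ℂ) : Integrable (fun t => g t * z t) unitMeasure :=
  hg.mul_bdd z.continuous.aestronglyMeasurable (Eventually.of_forall z.norm_coe_le_norm)

/-- The primitive of an integrable function, as a bounded continuous function. -/
def primitive (g : ℝ → ℂ) (hg : Integrable g unitMeasure) : ℝ →ᵇ ℂ :=
  BoundedContinuousFunction.ofNormedAddCommGroup (fun x => ∫ t in (0 : ℝ)..clamp x, g t)
    ((IsPrimitive.integral hg).continuousOn.comp_continuous continuous_clamp clamp_mem)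
    (∫ t, ‖g t‖ ∂unitMeasure) fun x => norm_intervalIntegral_le_integral_norm hg (clamp_mem x)

theorem primitive_apply {g : ℝ → ℂ} (hg : Integrable g unitMeasure) (x : ℝ) :
    primitive g hg x = ∫ t in (0 : ℝ)..clamp x, g t := rfl

theorem norm_primitive_le {g : ℝ → ℂ} (hg : Integrable g unitMeasure) :
    ‖primitive g hg‖ ≤ ∫ t, ‖g t‖ ∂unitMeasure :=
  BoundedContinuousFunction.norm_ofNormedAddCommGroup_le _
    (integral_nonneg fun _ => norm_nonneg _) _

theorem primitive_eq_add {g g₁ g₂ : ℝ → ℂ} (hg : Integrable g unitMeasure)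
    (hg₁ : Integrable g₁ unitMeasure) (hg₂ : Integrable g₂ unitMeasure)
    (h : g =ᵐ[unitMeasure] fun t => g₁ t + g₂ t) :
    primitive g hg = primitive g₁ hg₁ + primitive g₂ hg₂ := by
  ext x
  rw [BoundedContinuousFunction.add_apply, primitive_apply, primitive_apply, primitive_apply,
    intervalIntegral_congr_ae_unitMeasure h (clamp_mem x),
    intervalIntegral.integral_add (intervalIntegrable_of_mem_Icc hg₁ (clamp_mem x))
      (intervalIntegrable_of_mem_Icc hg₂ (clamp_mem x))]

theorem primitive_eq_smul {g g₁ : ℝ → ℂ} (hg : Integrable g unitMeasure)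
    (hg₁ : Integrable g₁ unitMeasure) (c : ℝ) (h : g =ᵐ[unitMeasure] fun t => c • g₁ t) :
    primitive g hg = c • primitive g₁ hg₁ := by
  ext x
  rw [BoundedContinuousFunction.smul_apply, primitive_apply, primitive_apply,
    intervalIntegral_congr_ae_unitMeasure h (clamp_mem x), intervalIntegral.integral_smul]

theorem isPrimitive_primitive {g : ℝ → ℂ} (hg : Integrable g unitMeasure) :
    IsPrimitive (primitive g hg) g :=
  (IsPrimitive.integral hg).congr
    (fun x hx => by rw [primitive_apply, clamp_of_mem hx]) (EventuallyEq.refl _ _)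

/-- The right-hand side of the equation `z' = i l z - i v z̄`. -/
def rhs (v : H) (l : ℝ) (z : ℝ → ℂ) (t : ℝ) : ℂ :=
  Complex.I * l * z t - Complex.I * pot v t * conj (z t)

theorem norm_rhs_le (v : H) (l : ℝ) (z : ℝ → ℂ) (t : ℝ) :
    ‖rhs v l z t‖ ≤ (|l| + ‖pot v t‖) * ‖z t‖ := by
  refine (norm_sub_le _ _).trans ?_
  simp [add_mul]

theorem integrable_rhs (v : H) (l : ℝ) (z : ℝ →ᵇ ℂ) : Integrable (rhs v l z) unitMeasure :=
  (integrable_mul_boundedContinuousFunction (integrable_const _) z).sub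
    (integrable_mul_boundedContinuousFunction ((integrable_pot v).const_mul _) (star z))

theorem rhs_add_left (p q : H × ℝ) (z : ℝ → ℂ) :
    rhs (p + q).1 (p + q).2 z =ᵐ[unitMeasure] fun t => rhs p.1 p.2 z t + rhs q.1 q.2 z t := by
  filter_upwards [pot_add p.1 q.1] with t ht
  simp only [rhs, Prod.fst_add, Prod.snd_add, ht]
  push_cast; ring

theorem rhs_smul_left (c : ℝ) (p : H × ℝ) (z : ℝ → ℂ) :
    rhs (c • p).1 (c • p).2 z =ᵐ[unitMeasure] fun t => c • rhs p.1 p.2 z t := by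
  filter_upwards [pot_smul c p.1] with t ht
  simp only [rhs, Prod.smul_fst, Prod.smul_snd, ht, Complex.real_smul, smul_eq_mul]
  push_cast; ring

theorem rhs_add_right (v : H) (l : ℝ) (z w : ℝ → ℂ) (t : ℝ) :
    rhs v l (z + w) t = rhs v l z t + rhs v l w t := by
  simp only [rhs, Pi.add_apply, map_add]
  ring

theorem rhs_smul_right (v : H) (l c : ℝ) (z : ℝ → ℂ) (t : ℝ) :
    rhs v l (c • z) t = c • rhs v l z t := by
  simp only [rhs, Pi.smul_apply, Complex.real_smul, map_mul, Complex.conj_ofReal]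
  ring

theorem integral_norm_rhs_le (p : H × ℝ) (z : ℝ →ᵇ ℂ) :
    ∫ t, ‖rhs p.1 p.2 z t‖ ∂unitMeasure ≤ 2 * ‖p‖ * ‖z‖ := by
  have hpot := (integrable_pot p.1).norm
  calc ∫ t, ‖rhs p.1 p.2 z t‖ ∂unitMeasure
      ≤ ∫ t, (|p.2| + ‖pot p.1 t‖) * ‖z‖ ∂unitMeasure := by
        refine integral_mono (integrable_rhs _ _ _).norm
          (((integrable_const _).add hpot).mul_const _) fun t => (norm_rhs_le _ _ _ _).trans ?_
        gcongr
        exact z.norm_coe_le_norm t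
    _ = (|p.2| + ∫ t, ‖pot p.1 t‖ ∂unitMeasure) * ‖z‖ := by
        rw [integral_mul_const, integral_add (integrable_const _) hpot]
        simp
    _ ≤ (‖p‖ + ‖p‖) * ‖z‖ := by
        gcongr
        · exact norm_snd_le p
        · exact (integral_norm_pot_le p.1).trans (norm_fst_le p)
    _ = 2 * ‖p‖ * ‖z‖ := by ring

/-- The Volterra operator `z ↦ ∫₀ˣ (i l z - i v z̄)`, depending linearly on `(v, l)`. -/
def volterra : (H × ℝ) →L[ℝ] (ℝ →ᵇ ℂ) →L[ℝ] (ℝ →ᵇ ℂ) :=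
  LinearMap.mkContinuous₂
    (LinearMap.mk₂ ℝ (fun p z => primitive (rhs p.1 p.2 z) (integrable_rhs _ _ _))
      (fun p q z => primitive_eq_add _ _ _ (rhs_add_left p q z))
      (fun c p z => primitive_eq_smul _ _ c (rhs_smul_left c p z))
      (fun p z w => primitive_eq_add _ _ _ (Eventually.of_forall (rhs_add_right p.1 p.2 z w)))
      (fun c p z => primitive_eq_smul _ _ c (Eventually.of_forall (rhs_smul_right p.1 p.2 c z))))
    2 fun p z => (norm_primitive_le (integrable_rhs p.1 p.2 z)).trans (integral_norm_rhs_le p z)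

theorem volterra_apply (p : H × ℝ) (z : ℝ →ᵇ ℂ) (x : ℝ) :
    volterra p z x = ∫ t in (0 : ℝ)..clamp x, rhs p.1 p.2 z t := rfl

theorem volterra_clamp (p : H × ℝ) (z : ℝ →ᵇ ℂ) (x : ℝ) :
    volterra p z (clamp x) = volterra p z x := by
  rw [volterra_apply, volterra_apply, clamp_of_mem (clamp_mem x)]

theorem volterra_zero (p : H × ℝ) (z : ℝ →ᵇ ℂ) : volterra p z 0 = 0 := by
  rw [volterra_apply, clamp_zero, intervalIntegral.integral_same]

theorem isPrimitive_volterra (p : H × ℝ) (z : ℝ →ᵇ ℂ) :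
    IsPrimitive (volterra p z) (rhs p.1 p.2 z) :=
  isPrimitive_primitive (integrable_rhs p.1 p.2 z)

theorem exists_norm_volterra_sq_le (p : H × ℝ) : ∃ C, 0 ≤ C ∧ ∀ (z : ℝ →ᵇ ℂ), ∀ x ∈ Icc (0 : ℝ) 1,
    ‖volterra p z x‖ ^ 2 ≤ C * ∫ t in (0 : ℝ)..x, ‖z t‖ ^ 2 := by
  set k : ℝ → ℝ := fun t => |p.2| + ‖pot p.1 t‖
  have hk0 (t : ℝ) : ‖k t‖ = k t := Real.norm_of_nonneg (by positivity)
  have hk : MemLp k 2 unitMeasure := (memLp_const |p.2|).add (memLp_pot p.1).norm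
  refine ⟨∫ t, ‖k t‖ ^ 2 ∂unitMeasure, integral_nonneg fun _ => sq_nonneg _, fun z x hx => ?_⟩
  have hz := memLp_boundedContinuousFunction z
  have hle : volume.restrict (Ioc 0 x) ≤ unitMeasure :=
    (Measure.restrict_mono (Ioc_subset_Ioc_right hx.2) le_rfl).trans
      restrict_Ioo_eq_restrict_Ioc.ge
  have hnorm : ‖volterra p z x‖ ≤ ∫ t in (0 : ℝ)..x, ‖k t‖ * ‖z t‖ := by
    rw [volterra_apply, clamp_of_mem hx]
    refine intervalIntegral.norm_integral_le_of_norm_le hx.1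
      (Eventually.of_forall fun t _ => (hk0 t).symm ▸ norm_rhs_le _ _ _ _) ?_
    exact intervalIntegrable_of_mem_Icc (hk.norm.integrable_mul hz.norm) hx
  have hCS := integral_norm_mul_norm_le (hk.mono_measure hle) (hz.mono_measure hle)
  simp only [← intervalIntegral.integral_of_le hx.1] at hCS
  have hz0 : 0 ≤ ∫ t in (0 : ℝ)..x, ‖z t‖ ^ 2 :=
    intervalIntegral.integral_nonneg hx.1 fun _ _ => sq_nonneg _
  calc ‖volterra p z x‖ ^ 2
      ≤ (√(∫ t in (0 : ℝ)..x, ‖k t‖ ^ 2) * √(∫ t in (0 : ℝ)..x, ‖z t‖ ^ 2)) ^ 2 := by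
        gcongr
        exact hnorm.trans hCS
    _ = (∫ t in (0 : ℝ)..x, ‖k t‖ ^ 2) * ∫ t in (0 : ℝ)..x, ‖z t‖ ^ 2 := by
        rw [mul_pow, Real.sq_sqrt (intervalIntegral.integral_nonneg hx.1 fun _ _ => sq_nonneg _),
          Real.sq_sqrt hz0]
    _ ≤ (∫ t, ‖k t‖ ^ 2 ∂unitMeasure) * ∫ t in (0 : ℝ)..x, ‖z t‖ ^ 2 := by
        rw [intervalIntegral.integral_of_le hx.1]
        gcongr ?_ * _
        exact integral_mono_measure hle (Eventually.of_forall fun _ => sq_nonneg _)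
          hk.norm.integrable_sq

theorem isUnit_one_sub_of_norm_pow_lt_one {R : Type*} [NormedRing R] [HasSummableGeomSeries R]
    {a : R} {n : ℕ} (h : ‖a ^ n‖ < 1) : IsUnit (1 - a) := by
  have hunit := isUnit_one_sub_of_norm_lt_one h
  rw [← mul_neg_geom_sum] at hunit
  refine ((Commute.isUnit_mul_iff (Commute.sum_right _ _ _ fun i _ => ?_)).1 hunit).1
  exact (Commute.one_left _).sub_left ((Commute.refl a).pow_right i)

theorem norm_pow_apply_sq_le_of_norm_sq_le_integral {T : (ℝ →ᵇ ℂ) →L[ℝ] (ℝ →ᵇ ℂ)} {C : ℝ}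
    (hC : 0 ≤ C)
    (hT : ∀ z, ∀ x ∈ Icc (0 : ℝ) 1, ‖T z x‖ ^ 2 ≤ C * ∫ t in (0 : ℝ)..x, ‖z t‖ ^ 2)
    (n : ℕ) (z : ℝ →ᵇ ℂ) :
    ∀ x ∈ Icc (0 : ℝ) 1, ‖(T ^ n) z x‖ ^ 2 ≤ C ^ n / n.factorial * ‖z‖ ^ 2 * x ^ n := by
  induction n with
  | zero =>
    intro x _
    simp only [pow_zero, one_apply_eq_self, Nat.factorial_zero, Nat.cast_one, mul_one, div_one,
      one_mul]
    gcongr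
    exact z.norm_coe_le_norm x
  | succ n ih =>
    intro x hx
    rw [pow_succ' T, mul_apply_eq_comp]
    calc ‖T ((T ^ n) z) x‖ ^ 2 ≤ C * ∫ t in (0 : ℝ)..x, ‖(T ^ n) z t‖ ^ 2 := hT _ x hx
      _ ≤ C * ∫ t in (0 : ℝ)..x, C ^ n / n.factorial * ‖z‖ ^ 2 * t ^ n := by
        gcongr
        exact intervalIntegral.integral_mono_on hx.1
          (Continuous.intervalIntegrable (by fun_prop) _ _)
          (Continuous.intervalIntegrable (by fun_prop) _ _)
          fun t ht => ih t ⟨ht.1, ht.2.trans hx.2⟩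
      _ = C ^ (n + 1) / (n + 1).factorial * ‖z‖ ^ 2 * x ^ (n + 1) := by
        rw [intervalIntegral.integral_const_mul, integral_pow, Nat.factorial_succ]
        have := Nat.factorial_ne_zero n
        push_cast
        field_simp
        ring

theorem isUnit_one_sub_volterra (p : H × ℝ) : IsUnit (1 - volterra p) := by
  obtain ⟨C, hC, hT⟩ := exists_norm_volterra_sq_le p
  obtain ⟨n, hn⟩ := (((tendsto_add_atTop_iff_nat 1).2
    (FloorSemiring.tendsto_pow_div_factorial_atTop C)).eventually
      (gt_mem_nhds (show (0 : ℝ) < 1 / 4 by norm_num))).exists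
  refine isUnit_one_sub_of_norm_pow_lt_one (R := (ℝ →ᵇ ℂ) →L[ℝ] (ℝ →ᵇ ℂ)) (n := n + 1) ?_
  refine (ContinuousLinearMap.opNorm_le_bound _ (M := 1 / 2) (by norm_num) fun z => ?_).trans_lt
    (by norm_num)
  refine (BoundedContinuousFunction.norm_le (by positivity)).2 fun x => ?_
  have hclamp : (volterra p ^ (n + 1)) z x = (volterra p ^ (n + 1)) z (clamp x) := by
    rw [pow_succ' (volterra p), mul_apply_eq_comp, volterra_clamp]
  have hx0 : 0 ≤ clamp x ^ (n + 1) := pow_nonneg (clamp_mem x).1 _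
  have hx : clamp x ^ (n + 1) ≤ 1 := pow_le_one₀ (clamp_mem x).1 (clamp_mem x).2
  rw [hclamp]
  refine (sq_le_sq₀ (norm_nonneg _) (by positivity)).1 ?_
  calc ‖(volterra p ^ (n + 1)) z (clamp x)‖ ^ 2
      ≤ C ^ (n + 1) / (n + 1).factorial * ‖z‖ ^ 2 * clamp x ^ (n + 1) :=
        norm_pow_apply_sq_le_of_norm_sq_le_integral hC hT _ z _ (clamp_mem x)
    _ ≤ 1 / 4 * ‖z‖ ^ 2 * 1 := by gcongr
    _ = (1 / 2 * ‖z‖) ^ 2 := by ring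

end Volterra

/-! ### Solutions of the complex equation -/

section ComplexSolution

/-- The solution of `z' = i l z - i v z̄`, `z(0) = c`, for `p = (v, l)`. -/
def sol (c : ℂ) (p : H × ℝ) : ℝ →ᵇ ℂ :=
  Ring.inverse (1 - volterra p) (BoundedContinuousFunction.const ℝ c)

theorem eq_sol_iff {c : ℂ} {p : H × ℝ} {z : ℝ →ᵇ ℂ} :
    z = sol c p ↔ z = BoundedContinuousFunction.const ℝ c + volterra p z := by
  have hunit := isUnit_one_sub_volterra p
  rw [← sub_eq_iff_eq_add]
  change _ ↔ (1 - volterra p) z = _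
  constructor
  · rintro rfl
    exact DFunLike.congr_fun (Ring.mul_inverse_cancel _ hunit) _
  · intro h
    rw [sol, ← h]
    exact (DFunLike.congr_fun (Ring.inverse_mul_cancel _ hunit) z).symm

theorem sol_eq (c : ℂ) (p : H × ℝ) :
    sol c p = BoundedContinuousFunction.const ℝ c + volterra p (sol c p) :=
  eq_sol_iff.1 rfl

theorem sol_apply (c : ℂ) (p : H × ℝ) (x : ℝ) : sol c p x = c + volterra p (sol c p) x :=
  DFunLike.congr_fun (sol_eq c p) x

theorem sol_zero (c : ℂ) (p : H × ℝ) : sol c p 0 = c := by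
  rw [sol_apply, volterra_zero, add_zero]

theorem sol_clamp (c : ℂ) (p : H × ℝ) (x : ℝ) : sol c p (clamp x) = sol c p x := by
  rw [sol_apply, volterra_clamp, ← sol_apply]

theorem isPrimitive_sol (c : ℂ) (p : H × ℝ) : IsPrimitive (sol c p) (rhs p.1 p.2 (sol c p)) :=
  ((IsPrimitive.const c).add (isPrimitive_volterra p (sol c p))).congr
    (fun x _ => sol_apply c p x) (Eventually.of_forall fun _ => (zero_add _).symm)

theorem contDiff_ringInverse_comp {𝕜 E R : Type*} [NontriviallyNormedField 𝕜]
    [NormedAddCommGroup E] [NormedSpace 𝕜 E] [NormedRing R] [NormedAlgebra 𝕜 R]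
    [HasSummableGeomSeries R] {n : WithTop ℕ∞} {f : E → R} (hf : ContDiff 𝕜 n f)
    (hunit : ∀ x, IsUnit (f x)) : ContDiff 𝕜 n (fun x => Ring.inverse (f x)) := by
  refine contDiff_iff_contDiffAt.2 fun x => ?_
  obtain ⟨u, hu⟩ := hunit x
  exact ContDiffAt.comp x (hu ▸ contDiffAt_ringInverse 𝕜 u) hf.contDiffAt

theorem contDiff_ringInverse_one_sub_apply {𝕜 E F : Type*} [NontriviallyNormedField 𝕜]
    [NormedAddCommGroup E] [NormedSpace 𝕜 E] [NormedAddCommGroup F] [NormedSpace 𝕜 F]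
    [CompleteSpace F] {n : WithTop ℕ∞} (L : E →L[𝕜] F →L[𝕜] F) (hunit : ∀ x, IsUnit (1 - L x))
    (c : F) : ContDiff 𝕜 n (fun x => Ring.inverse (1 - L x) c) :=
  (contDiff_ringInverse_comp (contDiff_const.sub L.contDiff) hunit).clm_apply contDiff_const

theorem contDiff_sol (c : ℂ) : ContDiff ℝ 1 (sol c) :=
  contDiff_ringInverse_one_sub_apply volterra isUnit_one_sub_volterra _

theorem hasFDerivAt_sol (c : ℂ) (p : H × ℝ) : HasFDerivAt (sol c) (fderiv ℝ (sol c) p) p :=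
  ((contDiff_sol c).differentiable one_ne_zero p).hasFDerivAt

theorem hasFDerivAt_sol_apply (c : ℂ) (p : H × ℝ) (x : ℝ) :
    HasFDerivAt (fun q => sol c q x)
      ((BoundedContinuousFunction.evalCLM ℝ x).comp (fderiv ℝ (sol c) p)) p :=
  (BoundedContinuousFunction.evalCLM (β := ℂ) ℝ x).hasFDerivAt.comp p (hasFDerivAt_sol c p)

theorem fderiv_sol_eq (c : ℂ) (p δ : H × ℝ) :
    fderiv ℝ (sol c) p δ = volterra p (fderiv ℝ (sol c) p δ) + volterra δ (sol c p) := by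
  have hright := (((volterra.hasFDerivAt (x := p)).clm_apply (hasFDerivAt_sol c p)).const_add
    (BoundedContinuousFunction.const ℝ c)).congr_of_eventuallyEq
      (Eventually.of_forall fun q => sol_eq c q)
  simpa using DFunLike.congr_fun ((hasFDerivAt_sol c p).unique hright) δ

theorem fderiv_sol_apply_zero (c : ℂ) (p δ : H × ℝ) : fderiv ℝ (sol c) p δ 0 = 0 := by
  rw [fderiv_sol_eq, BoundedContinuousFunction.add_apply, volterra_zero, volterra_zero, add_zero]

theorem isPrimitive_fderiv_sol (c : ℂ) (p δ : H × ℝ) :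
    IsPrimitive (fderiv ℝ (sol c) p δ)
      (fun t => rhs p.1 p.2 (fderiv ℝ (sol c) p δ) t + rhs δ.1 δ.2 (sol c p) t) :=
  ((isPrimitive_volterra p _).add (isPrimitive_volterra δ (sol c p))).congr
    (fun x _ => DFunLike.congr_fun (fderiv_sol_eq c p δ) x) (EventuallyEq.refl _ _)

theorem IsPrimitive.im_conj_mul {v : H} {l m : ℝ} {z w h : ℝ → ℂ} (hz : IsPrimitive z (rhs v l z))
    (hw : IsPrimitive w (fun t => rhs v m w t + h t)) :
    IsPrimitive (fun x => (conj (z x) * w x).im) (fun t =>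
      (m - l) * (conj (z t) * w t).re + (conj (z t) * h t).im) := by
  refine ((hz.conjugate.mul hw).clm_comp Complex.imCLM).congr (fun _ _ => rfl)
    (Eventually.of_forall fun t => ?_)
  simp [rhs]
  ring

theorem im_conj_sol_one_mul_sol_I (p : H × ℝ) (x : ℝ) :
    (conj (sol 1 p x) * sol Complex.I p x).im = 1 := by
  have hI : IsPrimitive (sol Complex.I p) fun t => rhs p.1 p.2 (sol Complex.I p) t + 0 := by
    simpa only [add_zero] using isPrimitive_sol Complex.I p
  have h := ((isPrimitive_sol 1 p).im_conj_mul hI).eq_apply_zero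
    (Eventually.of_forall fun t => by simp) (clamp_mem x)
  simpa [sol_clamp, sol_zero] using h

theorem sol_one_ne_zero (p : H × ℝ) (x : ℝ) : sol 1 p x ≠ 0 := by
  intro h
  simpa [h] using im_conj_sol_one_mul_sol_I p x

theorem norm_sol_one_pos (p : H × ℝ) (x : ℝ) : 0 < ‖sol 1 p x‖ :=
  norm_pos_iff.2 (sol_one_ne_zero p x)

end ComplexSolution

/-! ### The original system -/

section System

theorem integrable_fst (v : H) : Integrable (fun t => (v.fst t : ℂ)) unitMeasure :=
  ((Lp.memLp v.fst).integrable (by norm_num)).ofReal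

theorem integrable_snd (v : H) : Integrable (fun t => (v.snd t : ℂ)) unitMeasure :=
  ((Lp.memLp v.snd).integrable (by norm_num)).ofReal

theorem mulVec_system (v : H) (l : ℂ) (t : ℝ) (a : Fin 2 → ℂ) :
    (J * (V v t - l • (1 : Matrix (Fin 2) (Fin 2) ℂ))).mulVec a =
      ![(v.snd t : ℂ) * a 0 - (v.fst t + l) * a 1, (l - v.fst t) * a 0 - v.snd t * a 1] := by
  ext i
  fin_cases i <;>
    simp [J, V, Matrix.mulVec, Matrix.mul_apply, dotProduct, Fin.sum_univ_two] <;>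
    ring

theorem integrable_mulVec_system (v : H) (l : ℂ) {f : ℝ → Fin 2 → ℂ}
    (hf : ContinuousOn f (Icc 0 1)) :
    Integrable (fun t => (J * (V v t - l • (1 : Matrix (Fin 2) (Fin 2) ℂ))).mulVec (f t))
      unitMeasure := by
  have hf₀ := continuousOn_pi.1 hf 0
  have hf₁ := continuousOn_pi.1 hf 1
  have hfst := integrable_fst v
  have hsnd := integrable_snd v
  have hl : Integrable (fun _ => l) unitMeasure := integrable_const l
  simp only [mulVec_system]
  refine Integrable.of_eval fun i => ?_
  fin_cases i
  · exact (integrable_unitMeasure_mul_continuousOn hsnd hf₀).sub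
      (integrable_unitMeasure_mul_continuousOn (hfst.add hl) hf₁)
  · exact (integrable_unitMeasure_mul_continuousOn (hl.sub hfst) hf₀).sub
      (integrable_unitMeasure_mul_continuousOn hsnd hf₁)

theorem isSolution_iff {v : H} {l : ℂ} {f : ℝ → Fin 2 → ℂ} :
    IsSolution v l f ↔
      IsPrimitive (fun x => f x 0) (fun t => (v.snd t : ℂ) * f t 0 - (v.fst t + l) * f t 1) ∧
      IsPrimitive (fun x => f x 1) (fun t => (l - v.fst t) * f t 0 - v.snd t * f t 1) := by
  have h : IsSolution v l f ↔ IsPrimitive f fun t =>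
      (J * (V v t - l • (1 : Matrix (Fin 2) (Fin 2) ℂ))).mulVec (f t) :=
    ⟨fun hf => ⟨integrable_mulVec_system v l hf.1, hf.2⟩,
      fun hf => ⟨hf.continuousOn, hf.eq_add_integral⟩⟩
  simp only [h, IsPrimitive.pi_iff, Fin.forall_fin_two, mulVec_system, Matrix.cons_val_zero,
    Matrix.cons_val_one]

/-- The real coordinates of a complex number, as a vector of the original system. -/
def realPair (z : ℂ) : Fin 2 → ℂ := ![(z.re : ℂ), (z.im : ℂ)]

theorem isSolution_realPair {v : H} {l : ℝ} {z : ℝ → ℂ} (h : IsPrimitive z (rhs v l z)) :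
    IsSolution v l (fun x => realPair (z x)) := by
  refine isSolution_iff.2 ⟨(h.clm_comp (Complex.ofRealCLM.comp Complex.reCLM)).congr
    (fun _ _ => rfl) (Eventually.of_forall fun t => ?_),
    (h.clm_comp (Complex.ofRealCLM.comp Complex.imCLM)).congr
    (fun _ _ => rfl) (Eventually.of_forall fun t => ?_)⟩
  all_goals
    simp [realPair, rhs, pot]
    ring

theorem IsSolution.det_eq {v : H} {l : ℂ} {f g : ℝ → Fin 2 → ℂ} (hf : IsSolution v l f)
    (hg : IsSolution v l g) {x : ℝ} (hx : x ∈ Icc (0 : ℝ) 1) :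
    f x 0 * g x 1 - f x 1 * g x 0 = f 0 0 * g 0 1 - f 0 1 * g 0 0 := by
  rw [isSolution_iff] at hf hg
  refine ((hf.1.mul hg.2).sub (hf.2.mul hg.1)).eq_apply_zero (Eventually.of_forall fun t => ?_) hx
  simp only [Pi.zero_apply]
  ring

theorem isSolution_sol (v : H) (l : ℝ) (c : ℂ) :
    IsSolution v l (fun x => realPair (sol c (v, l) x)) :=
  isSolution_realPair (isPrimitive_sol c (v, l))

theorem IsSolution.eq_realPair_sol {v : H} {l : ℝ} {f : ℝ → Fin 2 → ℂ} (hf : IsSolution v l f)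
    {x : ℝ} (hx : x ∈ Icc (0 : ℝ) 1) :
    f x = f 0 0 • realPair (sol 1 (v, l) x) + f 0 1 • realPair (sol Complex.I (v, l) x) := by
  have h₁ := hf.det_eq (isSolution_sol v l 1) hx
  have hI := hf.det_eq (isSolution_sol v l Complex.I) hx
  have hdet : ((sol 1 (v, l) x).re : ℂ) * (sol Complex.I (v, l) x).im -
      (sol 1 (v, l) x).im * (sol Complex.I (v, l) x).re = 1 := by
    have h := im_conj_sol_one_mul_sol_I (v, l) x
    simp only [Complex.mul_im, Complex.conj_re, Complex.conj_im, neg_mul, ← sub_eq_add_neg] at h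
    exact_mod_cast h
  simp only [realPair, sol_zero, Matrix.cons_val_zero, Matrix.cons_val_one, Complex.one_re,
    Complex.one_im, Complex.I_re, Complex.I_im, Complex.ofReal_zero, Complex.ofReal_one, mul_zero,
    mul_one, zero_sub, sub_zero] at h₁ hI
  ext i
  fin_cases i
  · simp only [realPair, Fin.zero_eta, Matrix.smul_cons, smul_eq_mul, Matrix.smul_empty,
      Pi.add_apply, Matrix.cons_val_zero]
    linear_combination (-f x 0) * hdet + (sol 1 (v, l) x).re * hI - (sol Complex.I (v, l) x).re * h₁
  · simp only [realPair, Fin.mk_one, Matrix.smul_cons, smul_eq_mul, Matrix.smul_empty,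
      Pi.add_apply, Matrix.cons_val_one, Matrix.cons_val_fin_one]
    linear_combination (-f x 1) * hdet + (sol 1 (v, l) x).im * hI - (sol Complex.I (v, l) x).im * h₁

theorem solution_one (v : H) (l : ℝ) (c : ℂ) :
    solution v l (realPair c) 1 =
      (c.re : ℂ) • realPair (sol 1 (v, l) 1) + (c.im : ℂ) • realPair (sol Complex.I (v, l) 1) := by
  have h : IsSolution v l (solution v l (realPair c)) ∧ solution v l (realPair c) 0 = realPair c :=
    Classical.epsilon_spec (p := fun f => IsSolution v l f ∧ f 0 = realPair c)
      ⟨_, isSolution_sol v l c, by rw [sol_zero]⟩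
  rw [h.1.eq_realPair_sol (right_mem_Icc.2 zero_le_one), h.2]
  rfl

theorem theta_one (v : H) (l : ℝ) : theta v l 1 = realPair (sol 1 (v, l) 1) := by
  simpa [realPair, theta] using solution_one v l 1

theorem phi_one (v : H) (l : ℝ) : phi v l 1 = realPair (sol Complex.I (v, l) 1) := by
  simpa [realPair, phi] using solution_one v l Complex.I

end System

/-! ### Eigenvalues -/

section Eigenvalues

theorem IsSolution.lagrange_identity {v : H} {l : ℂ} {f : ℝ → Fin 2 → ℂ} (hf : IsSolution v l f) :
    f 1 0 * conj (f 1 1) - f 1 1 * conj (f 1 0) =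
      f 0 0 * conj (f 0 1) - f 0 1 * conj (f 0 0) +
        (conj l - l) * ((∫ t, (‖f t 0‖ ^ 2 + ‖f t 1‖ ^ 2) ∂unitMeasure : ℝ) : ℂ) := by
  rw [isSolution_iff] at hf
  rw [((hf.1.mul hf.2.conjugate).sub (hf.2.mul hf.1.conjugate)).apply_one,
    ← integral_complex_ofReal, ← integral_const_mul]
  congr 1
  refine integral_congr_ae (Eventually.of_forall fun t => ?_)
  simp only [map_sub, map_mul, map_add, Complex.conj_ofReal, Complex.ofReal_add,
    Complex.ofReal_pow, ← Complex.mul_conj']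
  ring

theorem integral_norm_sq_add_pos {f : ℝ → Fin 2 → ℂ} (hf : ContinuousOn f (Icc 0 1)) {x : ℝ}
    (hx : x ∈ Icc (0 : ℝ) 1) (hne : f x ≠ 0) :
    0 < ∫ t, (‖f t 0‖ ^ 2 + ‖f t 1‖ ^ 2) ∂unitMeasure := by
  rw [integral_unitMeasure]
  refine intervalIntegral.integral_pos zero_lt_one
    (((continuousOn_pi.1 hf 0).norm.pow 2).add ((continuousOn_pi.1 hf 1).norm.pow 2))
    (fun _ _ => by positivity) ⟨x, hx, ?_⟩
  obtain ⟨i, hi⟩ := Function.ne_iff.1 hne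
  have hpos : 0 < ‖f x i‖ := norm_pos_iff.2 hi
  fin_cases i <;> simp only [Fin.zero_eta, Fin.mk_one] at hpos <;> positivity

theorem ofReal_re_of_mem_eigenvalues {v : H} {i k : Fin 2} {l : ℂ} (h : l ∈ eigenvalues v i k) :
    (l.re : ℂ) = l := by
  obtain ⟨f, hf, ⟨x, hx, hne⟩, h0, h1⟩ := h
  have hleft : f 0 0 * conj (f 0 1) - f 0 1 * conj (f 0 0) = 0 := by
    fin_cases i <;> simp_all
  have hright : f 1 0 * conj (f 1 1) - f 1 1 * conj (f 1 0) = 0 := by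
    fin_cases k <;> simp_all
  have h := hf.lagrange_identity
  rw [hleft, hright, zero_add, eq_comm, mul_eq_zero] at h
  have hpos := integral_norm_sq_add_pos hf.1 hx hne
  exact Complex.conj_eq_iff_re.1
    (sub_eq_zero.1 (h.resolve_right (Complex.ofReal_ne_zero.2 hpos.ne')))

theorem eigenvalues_one_left (v : H) (k : Fin 2) :
    eigenvalues v 1 k = Complex.ofReal '' {r | realPair (sol 1 (v, r) 1) k = 0} := by
  ext l
  constructor
  · intro h
    have hreal := ofReal_re_of_mem_eigenvalues h
    obtain ⟨f, hf, ⟨x, hx, hne⟩, h0, h1⟩ := h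
    rw [← hreal] at hf
    have hf_eq {y : ℝ} (hy : y ∈ Icc (0 : ℝ) 1) :
        f y = f 0 0 • realPair (sol 1 (v, l.re) y) := by
      simpa [h0] using hf.eq_realPair_sol hy
    have hf0 : f 0 0 ≠ 0 := fun h => hne (by rw [hf_eq hx, h, zero_smul])
    refine ⟨l.re, ?_, hreal⟩
    rw [hf_eq (right_mem_Icc.2 zero_le_one)] at h1
    exact (mul_eq_zero.1 h1).resolve_left hf0
  · rintro ⟨r, hr, rfl⟩
    refine ⟨_, isSolution_sol v r 1, ⟨0, left_mem_Icc.2 zero_le_one, fun h => ?_⟩, ?_, hr⟩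
    · simpa [sol_zero, realPair] using congrFun h 0
    · simp [sol_zero, realPair]

end Eigenvalues

/-! ### The symmetry `v ↦ -v` -/

section Negation

-- Since `J V = -V J`, rotation by a quarter turn changes the sign of the potential.
theorem IsSolution.rotate {v : H} {l : ℂ} {f : ℝ → Fin 2 → ℂ} (hf : IsSolution v l f) :
    IsSolution (-v) l (fun x => ![-f x 1, f x 0]) := by
  rw [isSolution_iff] at hf ⊢
  have hneg : ∀ᵐ t ∂unitMeasure, (-v).fst t = -v.fst t ∧ (-v).snd t = -v.snd t := by
    filter_upwards [Lp.coeFn_neg v.fst, Lp.coeFn_neg v.snd] with t hfst hsnd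
    exact ⟨hfst, hsnd⟩
  refine ⟨(hf.2.const_mul (-1)).congr (fun _ _ => by simp) ?_, hf.1.congr (fun _ _ => rfl) ?_⟩
  all_goals
    filter_upwards [hneg] with t ht
    simp only [ht.1, ht.2, Matrix.cons_val_zero, Matrix.cons_val_one, Complex.ofReal_neg]
    ring

theorem eigenvalues_subset_neg (v : H) (i k : Fin 2) :
    eigenvalues v i k ⊆ eigenvalues (-v) (i + 1) (k + 1) := by
  rintro l ⟨f, hf, ⟨x, hx, hne⟩, h0, h1⟩
  refine ⟨_, hf.rotate, ⟨x, hx, fun h => hne ?_⟩, ?_, ?_⟩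
  · have h₀ : f x 1 = 0 := by simpa using congrFun h 0
    have h₁ : f x 0 = 0 := congrFun h 1
    ext j
    fin_cases j
    · exact h₁
    · exact h₀
  · fin_cases i <;> simp_all
  · fin_cases k <;> simp_all

theorem eigenvalues_neg (v : H) (i k : Fin 2) :
    eigenvalues (-v) (i + 1) (k + 1) = eigenvalues v i k := by
  refine Subset.antisymm ?_ (eigenvalues_subset_neg v i k)
  have h := eigenvalues_subset_neg (-v) (i + 1) (k + 1)
  have htwo (j : Fin 2) : j + 1 + 1 = j := by fin_cases j <;> rfl
  rwa [neg_neg, htwo, htwo] at h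

theorem volterra_I_smul (v : H) (l : ℝ) (z : ℝ →ᵇ ℂ) :
    volterra (v, l) (Complex.I • z) = Complex.I • volterra (-v, l) z := by
  ext x
  rw [BoundedContinuousFunction.smul_apply, volterra_apply, volterra_apply,
    ← intervalIntegral.integral_smul]
  refine intervalIntegral_congr_ae_unitMeasure ?_ (clamp_mem x)
  filter_upwards [pot_neg v] with t ht
  simp only [rhs, ht, BoundedContinuousFunction.coe_smul, smul_eq_mul, map_mul, Complex.conj_I]
  ring

theorem sol_I (v : H) (l : ℝ) : sol Complex.I (v, l) = Complex.I • sol 1 (-v, l) := by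
  refine (eq_sol_iff.2 ?_).symm
  rw [volterra_I_smul]
  ext x
  simp [sol_apply 1 (-v, l) x, mul_add]

theorem phi_one_zero (v : H) (l : ℝ) : phi v l 1 0 = -theta (-v) l 1 1 := by
  rw [phi_one, theta_one, sol_I]
  simp [realPair]

end Negation

/-! ### The Prüfer angle -/

section Angle

theorem isUnit_of_le_norm_apply {α 𝕜 : Type*} [TopologicalSpace α] [NormedField 𝕜] {z : α →ᵇ 𝕜}
    {ε : ℝ} (hε : 0 < ε) (h : ∀ x, ε ≤ ‖z x‖) : IsUnit z := by
  have hne (x : α) : z x ≠ 0 := norm_pos_iff.1 (hε.trans_le (h x))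
  have hbound (x : α) : ‖(z x)⁻¹‖ ≤ ε⁻¹ := by
    rw [norm_inv]
    exact inv_anti₀ hε (h x)
  refine IsUnit.of_mul_eq_one (BoundedContinuousFunction.ofNormedAddCommGroup (fun x => (z x)⁻¹)
    (z.continuous.inv₀ hne) ε⁻¹ hbound) ?_
  ext x
  exact mul_inv_cancel₀ (hne x)

theorem isUnit_sol_one (p : H × ℝ) : IsUnit (sol 1 p) := by
  have h (x : ℝ) : 1 ≤ ‖sol Complex.I p‖ * ‖sol 1 p x‖ := by
    rw [← im_conj_sol_one_mul_sol_I p x]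
    refine (Complex.im_le_norm _).trans ?_
    rw [norm_mul, RCLike.norm_conj, mul_comm]
    gcongr
    exact (sol Complex.I p).norm_coe_le_norm x
  have hpos : 0 < ‖sol Complex.I p‖ :=
    pos_of_mul_pos_left (one_pos.trans_le (h 0)) (norm_nonneg _)
  exact isUnit_of_le_norm_apply (inv_pos.2 hpos) fun x => (inv_le_iff_one_le_mul₀' hpos).2 (h x)

theorem inverse_sol_one_apply (p : H × ℝ) (x : ℝ) :
    Ring.inverse (sol 1 p) x = (sol 1 p x)⁻¹ :=
  eq_inv_of_mul_eq_one_right (DFunLike.congr_fun (Ring.mul_inverse_cancel _ (isUnit_sol_one p)) x)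

/-- The unimodular function `z / z̄`, where `z` is the solution with `z(0) = 1`. -/
def phase (p : H × ℝ) : ℝ →ᵇ ℂ := sol 1 p * star (Ring.inverse (sol 1 p))

theorem phase_apply (p : H × ℝ) (x : ℝ) : phase p x = sol 1 p x * conj (sol 1 p x)⁻¹ := by
  rw [← inverse_sol_one_apply]
  rfl

theorem norm_phase_apply (p : H × ℝ) (x : ℝ) : ‖phase p x‖ = 1 := by
  rw [phase_apply, norm_mul, RCLike.norm_conj, norm_inv,
    mul_inv_cancel₀ (norm_sol_one_pos p x).ne']

theorem contDiff_phase : ContDiff ℝ 1 phase :=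
  (contDiff_sol 1).mul ((starL' ℝ (A := ℝ →ᵇ ℂ)).contDiff.comp
    (contDiff_ringInverse_comp (contDiff_sol 1) isUnit_sol_one))

/-- The continuous logarithm of the solution `z` with `z(0) = 1`, obtained by integrating
`z' / z = i l - i v z̄ / z`. -/
def logSol (x : ℝ) (p : H × ℝ) : ℂ := Complex.I * p.2 * x + volterra (p.1, 0) (phase p) x

/-- The Prüfer angle, which is the continuous argument of the solution `z` with `z(0) = 1`, at the
right end point. -/
def angle (p : H × ℝ) : ℝ := (logSol 1 p).im

theorem isPrimitive_logSol (p : H × ℝ) : IsPrimitive (fun x => logSol x p)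
    (fun t => Complex.I * p.2 - Complex.I * pot p.1 t * conj (phase p t)) := by
  refine ((IsPrimitive.ofReal.const_mul (Complex.I * p.2)).add
    (isPrimitive_volterra (p.1, 0) (phase p))).congr (fun x _ => rfl)
    (Eventually.of_forall fun t => ?_)
  simp only [rhs, Complex.ofReal_zero]
  ring

theorem logSol_zero (p : H × ℝ) : logSol 0 p = 0 := by
  simp [logSol, volterra_zero]

theorem sol_one_eq_exp_logSol (p : H × ℝ) {x : ℝ} (hx : x ∈ Icc (0 : ℝ) 1) :
    sol 1 p x = Complex.exp (logSol x p) := by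
  have h := ((isPrimitive_sol 1 p).mul ((isPrimitive_logSol p).const_mul (-1)).cexp).eq_apply_zero
    (Eventually.of_forall fun t => by
      have := sol_one_ne_zero p t
      simp only [rhs, phase_apply, map_mul, Complex.conj_conj, Pi.zero_apply]
      field_simp
      ring) hx
  simp only [sol_zero, logSol_zero, mul_zero, Complex.exp_zero, mul_one, neg_mul, one_mul,
    Complex.exp_neg] at h
  exact eq_of_mul_inv_eq_one h

theorem norm_volterra_phase_le (p : H × ℝ) (x : ℝ) :
    ‖volterra (p.1, 0) (phase p) x‖ ≤ ‖p.1‖ := by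
  rw [volterra_apply]
  refine (norm_intervalIntegral_le_integral_norm (integrable_rhs _ _ _) (clamp_mem x)).trans ?_
  refine le_trans (le_of_eq ?_) (integral_norm_pot_le p.1)
  simp [rhs, norm_phase_apply]

theorem abs_re_logSol_le (p : H × ℝ) (x : ℝ) : |(logSol x p).re| ≤ ‖p.1‖ := by
  have h : (logSol x p).re = (volterra (p.1, 0) (phase p) x).re := by simp [logSol]
  exact h ▸ (Complex.abs_re_le_norm _).trans (norm_volterra_phase_le p x)

theorem norm_sol_one (p : H × ℝ) {x : ℝ} (hx : x ∈ Icc (0 : ℝ) 1) :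
    ‖sol 1 p x‖ = Real.exp (logSol x p).re := by
  rw [sol_one_eq_exp_logSol p hx, Complex.norm_exp]

theorem norm_sol_one_le (p : H × ℝ) (x : ℝ) : ‖sol 1 p x‖ ≤ Real.exp ‖p.1‖ := by
  rw [← sol_clamp, norm_sol_one p (clamp_mem x)]
  exact Real.exp_le_exp.2 (abs_le.1 (abs_re_logSol_le p _)).2

theorem exp_neg_le_norm_sol_one (p : H × ℝ) (x : ℝ) : Real.exp (-‖p.1‖) ≤ ‖sol 1 p x‖ := by
  rw [← sol_clamp, norm_sol_one p (clamp_mem x)]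
  exact Real.exp_le_exp.2 (abs_le.1 (abs_re_logSol_le p _)).1

theorem abs_angle_sub_le (p : H × ℝ) : |angle p - p.2| ≤ ‖p.1‖ := by
  have h : angle p - p.2 = (volterra (p.1, 0) (phase p) 1).im := by simp [angle, logSol]
  exact h ▸ (Complex.abs_im_le_norm _).trans (norm_volterra_phase_le p 1)

theorem sol_one_apply_one (p : H × ℝ) :
    sol 1 p 1 = ‖sol 1 p 1‖ * Complex.exp (angle p * Complex.I) := by
  have h1 : (1 : ℝ) ∈ Icc (0 : ℝ) 1 := right_mem_Icc.2 zero_le_one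
  rw [norm_sol_one p h1, sol_one_eq_exp_logSol p h1, Complex.ofReal_exp, ← Complex.exp_add, angle,
    Complex.re_add_im]

theorem contDiff_clm_apply₂ {𝕜 D E F G : Type*} [NontriviallyNormedField 𝕜]
    [NormedAddCommGroup D] [NormedSpace 𝕜 D] [NormedAddCommGroup E] [NormedSpace 𝕜 E]
    [NormedAddCommGroup F] [NormedSpace 𝕜 F] [NormedAddCommGroup G] [NormedSpace 𝕜 G]
    {n : WithTop ℕ∞} (L : E →L[𝕜] F →L[𝕜] G) {f : D → E} {g : D → F} (hf : ContDiff 𝕜 n f)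
    (hg : ContDiff 𝕜 n g) : ContDiff 𝕜 n (fun x => L (f x) (g x)) :=
  (L.contDiff.comp hf).clm_apply hg

theorem contDiff_logSol (x : ℝ) : ContDiff ℝ 1 (logSol x) := by
  have hvolterra : ContDiff ℝ 1 fun p : H × ℝ => volterra (p.1, 0) (phase p) :=
    contDiff_clm_apply₂ volterra (contDiff_fst.prodMk contDiff_const) contDiff_phase
  have hspectral : ContDiff ℝ 1 fun p : H × ℝ => (p.2 : ℂ) :=
    Complex.ofRealCLM.contDiff.comp contDiff_snd
  exact ((contDiff_const.mul hspectral).mul contDiff_const).add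
    ((BoundedContinuousFunction.evalCLM (β := ℂ) ℝ x).contDiff.comp hvolterra)

theorem hasFDerivAt_logSol (x : ℝ) (p : H × ℝ) :
    HasFDerivAt (logSol x) (fderiv ℝ (logSol x) p) p :=
  ((contDiff_logSol x).differentiable one_ne_zero p).hasFDerivAt

theorem contDiff_angle : ContDiff ℝ 1 angle := Complex.imCLM.contDiff.comp (contDiff_logSol 1)

theorem hasFDerivAt_angle (p : H × ℝ) :
    HasFDerivAt angle (Complex.imCLM.comp (fderiv ℝ (logSol 1) p)) p :=
  Complex.imCLM.hasFDerivAt.comp p (hasFDerivAt_logSol 1 p)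

theorem fderiv_sol_one_apply (p δ : H × ℝ) {x : ℝ} (hx : x ∈ Icc (0 : ℝ) 1) :
    fderiv ℝ (sol 1) p δ x = sol 1 p x * fderiv ℝ (logSol x) p δ := by
  have h := (hasFDerivAt_logSol x p).cexp.congr_of_eventuallyEq
    (Eventually.of_forall fun q => sol_one_eq_exp_logSol q hx)
  rw [sol_one_eq_exp_logSol p hx]
  exact DFunLike.congr_fun ((hasFDerivAt_sol_apply 1 p x).unique h) δ

end Angle

/-! ### Variation of the logarithm -/

section Variation

/-- The element of `H` with complex potential `w`. -/
def toH (w : ℝ →ᵇ ℂ) : H :=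
  WithLp.toLp 2
    ((memLp_boundedContinuousFunction w).re.toLp, (memLp_boundedContinuousFunction w).im.toLp)

theorem pot_toH (w : ℝ →ᵇ ℂ) : pot (toH w) =ᵐ[unitMeasure] w := by
  filter_upwards [(memLp_boundedContinuousFunction w).re.coeFn_toLp,
    (memLp_boundedContinuousFunction w).im.coeFn_toLp] with t hre him
  exact Complex.ext ((pot_re _ t).trans hre) ((pot_im _ t).trans him)

theorem inner_toH (w : ℝ →ᵇ ℂ) (v : H) :
    inner ℝ (toH w) v = ∫ t, (conj (w t) * pot v t).re ∂unitMeasure := by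
  rw [inner_eq_integral]
  refine integral_congr_ae ?_
  filter_upwards [pot_toH w] with t ht
  rw [ht]

/-- `∫ |z|²` for the solution `z` with `z(0) = 1`. -/
def solNormSq (p : H × ℝ) : ℝ := ∫ t, ‖sol 1 p t‖ ^ 2 ∂unitMeasure

/-- `∫ Re (ȳ z)` for the solutions `z`, `y` with `z(0) = 1`, `y(0) = i`. -/
def solCross (p : H × ℝ) : ℝ := ∫ t, (conj (sol Complex.I p t) * sol 1 p t).re ∂unitMeasure

theorem exp_neg_sq_le_solNormSq (p : H × ℝ) : Real.exp (-‖p.1‖) ^ 2 ≤ solNormSq p := by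
  calc Real.exp (-‖p.1‖) ^ 2 = ∫ _, Real.exp (-‖p.1‖) ^ 2 ∂unitMeasure := by simp
    _ ≤ solNormSq p := by
      refine integral_mono (integrable_const _)
        (memLp_boundedContinuousFunction (sol 1 p)).norm.integrable_sq fun t => ?_
      exact pow_le_pow_left₀ (Real.exp_nonneg _) (exp_neg_le_norm_sol_one p t) 2

theorem solNormSq_pos (p : H × ℝ) : 0 < solNormSq p :=
  (by positivity : 0 < Real.exp (-‖p.1‖) ^ 2).trans_le (exp_neg_sq_le_solNormSq p)

theorem im_conj_sol_mul_fderiv_sol (c d : ℂ) (p δ : H × ℝ) :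
    (conj (sol c p 1) * fderiv ℝ (sol d) p δ 1).im =
      δ.2 * ∫ t, (conj (sol c p t) * sol d p t).re ∂unitMeasure -
        inner ℝ (toH (sol c p * sol d p)) δ.1 := by
  have hre : Integrable (fun t => (conj (sol c p t) * sol d p t).re) unitMeasure :=
    ((memLp_boundedContinuousFunction (star (sol c p) * sol d p)).integrable (by norm_num)).re
  have hpot : Integrable (fun t => (conj ((sol c p * sol d p) t) * pot δ.1 t).re) unitMeasure :=
    ((integrable_mul_boundedContinuousFunction (integrable_pot δ.1)
      (star (sol c p * sol d p))).congr (Eventually.of_forall fun t => mul_comm _ _)).re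
  rw [((isPrimitive_sol c p).im_conj_mul (isPrimitive_fderiv_sol d p δ)).apply_one,
    fderiv_sol_apply_zero, mul_zero, Complex.zero_im, zero_add, inner_toH, ← integral_const_mul,
    ← integral_sub (hre.const_mul _) hpot]
  refine integral_congr_ae (Eventually.of_forall fun t => ?_)
  simp [rhs]
  ring

theorem im_fderiv_logSol (p δ : H × ℝ) :
    ‖sol 1 p 1‖ ^ 2 * (fderiv ℝ (logSol 1) p δ).im =
      δ.2 * solNormSq p - inner ℝ (toH (sol 1 p * sol 1 p)) δ.1 := by
  have h := im_conj_sol_mul_fderiv_sol 1 1 p δ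
  simp only [fderiv_sol_one_apply p δ (right_mem_Icc.2 zero_le_one), ← mul_assoc, Complex.conj_mul',
    ← Complex.ofReal_pow, Complex.im_ofReal_mul, Complex.ofReal_re] at h
  exact h

theorem re_fderiv_logSol {p δ : H × ℝ} (him : (fderiv ℝ (logSol 1) p δ).im = 0) :
    (fderiv ℝ (logSol 1) p δ).re =
      inner ℝ (toH (sol 1 p * sol Complex.I p)) δ.1 - δ.2 * solCross p := by
  have hwronskian := im_conj_sol_one_mul_sol_I p 1
  have h := im_conj_sol_mul_fderiv_sol Complex.I 1 p δ
  rw [fderiv_sol_one_apply p δ (right_mem_Icc.2 zero_le_one), ← mul_assoc, Complex.mul_im, him,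
    mul_zero, zero_add, mul_comm (sol Complex.I p)] at h
  simp only [Complex.mul_im, Complex.conj_re, Complex.conj_im] at h hwronskian
  rw [solCross]
  linear_combination -(fderiv ℝ (logSol 1) p δ).re * hwronskian - h

end Variation

/-! ### Level sets of the angle -/

section Level

theorem im_fderiv_logSol_spectral_pos (p : H × ℝ) : 0 < (fderiv ℝ (logSol 1) p (0, 1)).im := by
  have h := im_fderiv_logSol p (0, 1)
  simp only [one_mul, inner_zero_right, sub_zero] at h
  exact pos_of_mul_pos_right (h ▸ solNormSq_pos p) (sq_nonneg _)

theorem strictMono_angle (v : H) : StrictMono fun l => angle (v, l) := by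
  refine strictMono_of_deriv_pos fun l => ?_
  have hline : HasDerivAt (fun l : ℝ => (v, l)) ((0 : H), (1 : ℝ)) l :=
    (hasDerivAt_const l v).prodMk (hasDerivAt_id l)
  exact ((hasFDerivAt_angle (v, l)).comp_hasDerivAt l hline).deriv ▸
    im_fderiv_logSol_spectral_pos (v, l)

theorem surjective_angle (v : H) : Function.Surjective fun l => angle (v, l) := by
  have hbound (l : ℝ) : -‖v‖ ≤ angle (v, l) - l ∧ angle (v, l) - l ≤ ‖v‖ :=
    abs_le.1 (abs_angle_sub_le (v, l))
  refine (contDiff_angle.continuous.comp (by fun_prop)).surjective ?_ ?_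
  · exact tendsto_atTop_mono (fun l => le_sub_iff_add_le'.1 (hbound l).1)
      (tendsto_atTop_add_const_right _ (-‖v‖) tendsto_id)
  · exact tendsto_atBot_mono (fun l => sub_le_iff_le_add'.1 (hbound l).2)
      (tendsto_atBot_add_const_right _ ‖v‖ tendsto_id)

/-- The value of the spectral parameter at which the angle of the solution with `z(0) = 1`, taken
at the right end point, equals `c`. -/
def level (c : ℝ) (v : H) : ℝ := (surjective_angle v c).choose

theorem angle_level (c : ℝ) (v : H) : angle (v, level c v) = c := (surjective_angle v c).choose_spec

theorem eq_level {c l : ℝ} {v : H} (h : angle (v, l) = c) : l = level c v :=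
  (strictMono_angle v).injective (h.trans (angle_level c v).symm)

theorem differentiableAt_level (c : ℝ) (v : H) : DifferentiableAt ℝ (level c) v := by
  have hangle : ContDiffAt ℝ 1 angle (v, level c v) := contDiff_angle.contDiffAt
  have hinv : (fderiv ℝ angle (v, level c v) ∘L .inr ℝ H ℝ).IsInvertible := by
    rw [(hasFDerivAt_angle _).fderiv]
    refine ⟨ContinuousLinearEquiv.unitsEquivAut ℝ
      (Units.mk0 _ (im_fderiv_logSol_spectral_pos (v, level c v)).ne'), ?_⟩
    ext
    simp
  refine (hangle.hasStrictFDerivAt_implicitFunction one_ne_zero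
    hinv).hasFDerivAt.differentiableAt.congr_of_eventuallyEq ?_
  filter_upwards [hangle.eventually_apply_implicitFunction one_ne_zero hinv] with w hw
  exact (eq_level (hw.trans (angle_level c v))).symm

theorem hasFDerivAt_graph_level (c : ℝ) (v : H) : HasFDerivAt (fun w => (w, level c w))
    ((ContinuousLinearMap.id ℝ H).prod (fderiv ℝ (level c) v)) v :=
  (hasFDerivAt_id v).prodMk (differentiableAt_level c v).hasFDerivAt

theorem im_fderiv_logSol_level (c : ℝ) (v δ : H) :
    (fderiv ℝ (logSol 1) (v, level c v) (δ, fderiv ℝ (level c) v δ)).im = 0 := by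
  have hconst : HasFDerivAt (angle ∘ fun w => (w, level c w)) (0 : H →L[ℝ] ℝ) v :=
    (hasFDerivAt_const c v).congr_of_eventuallyEq (Eventually.of_forall (angle_level c))
  exact DFunLike.congr_fun
    (((hasFDerivAt_angle (v, level c v)).comp v (hasFDerivAt_graph_level c v)).unique hconst) δ

/-- The gradient of `level c`. -/
def levelGrad (c : ℝ) (v : H) : H :=
  (solNormSq (v, level c v))⁻¹ • toH (sol 1 (v, level c v) * sol 1 (v, level c v))

theorem hasGradientAt_level (c : ℝ) (v : H) : HasGradientAt (level c) (levelGrad c v) v := by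
  rw [hasGradientAt_iff_hasFDerivAt]
  refine (differentiableAt_level c v).hasFDerivAt.congr_fderiv ?_
  ext δ
  have hvariation := im_fderiv_logSol (v, level c v) (δ, fderiv ℝ (level c) v δ)
  rw [im_fderiv_logSol_level, mul_zero, eq_comm, sub_eq_zero] at hvariation
  rw [InnerProductSpace.toDual_apply_apply, levelGrad, real_inner_smul_left, ← hvariation,
    mul_comm, mul_inv_cancel_right₀ (solNormSq_pos _).ne']

/-- The norming constant belonging to `level c`. -/
def norming (c : ℝ) (v : H) : ℝ := -Real.log ‖sol 1 (v, level c v) 1‖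

/-- The gradient of `norming c`. -/
def normingGrad (c : ℝ) (v : H) : H :=
  solCross (v, level c v) • levelGrad c v -
    toH (sol 1 (v, level c v) * sol Complex.I (v, level c v))

theorem norming_eq_neg_re_logSol (c : ℝ) (v : H) :
    norming c v = -(logSol 1 (v, level c v)).re := by
  rw [norming, norm_sol_one _ (right_mem_Icc.2 zero_le_one), Real.log_exp]

theorem hasGradientAt_norming (c : ℝ) (v : H) :
    HasGradientAt (norming c) (normingGrad c v) v := by
  rw [hasGradientAt_iff_hasFDerivAt, funext (norming_eq_neg_re_logSol c)]
  refine ((Complex.reCLM.hasFDerivAt.comp v ((hasFDerivAt_logSol 1 (v, level c v)).comp v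
    (hasFDerivAt_graph_level c v))).neg).congr_fderiv ?_
  ext δ
  have hlevel : fderiv ℝ (level c) v δ = inner ℝ (levelGrad c v) δ :=
    (hasGradientAt_level c v).fderiv_apply
  have hre := re_fderiv_logSol (im_fderiv_logSol_level c v δ)
  rw [InnerProductSpace.toDual_apply_apply, normingGrad, inner_sub_left, real_inner_smul_left,
    ← hlevel]
  simp only [neg_apply, ContinuousLinearMap.comp_apply,
    ContinuousLinearMap.prod_apply, ContinuousLinearMap.id_apply, Complex.reCLM_apply, hre]
  ring

end Level

/-! ### The symplectic form -/

section Symplectic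

theorem wedge_antisymm (f g : H) : wedge f g = -wedge g f := by
  rw [wedge, wedge, ← integral_neg]
  congr 1
  ext x
  ring

theorem wedge_self (f : H) : wedge f f = 0 := self_eq_neg.1 (wedge_antisymm f f)

/-- Multiplication by `i` on `H`; it represents the symplectic form by the inner product. -/
def rotH (f : H) : H := WithLp.toLp 2 (-f.snd, f.fst)

theorem wedge_eq_inner (f g : H) : wedge f g = inner ℝ (rotH f) g := by
  rw [wedge_eq_integral, inner_eq_integral]
  refine integral_congr_ae ?_
  filter_upwards [Lp.coeFn_neg f.snd] with t ht
  have hfst : (rotH f).fst t = -f.snd t := ht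
  have hsnd : (rotH f).snd t = f.fst t := rfl
  simp only [Complex.mul_re, Complex.mul_im, Complex.conj_re, Complex.conj_im, pot_re, pot_im, hfst,
    hsnd]
  ring

theorem wedge_sub_right (f g h : H) : wedge f (g - h) = wedge f g - wedge f h := by
  simp only [wedge_eq_inner, inner_sub_right]

theorem wedge_smul_right (f g : H) (r : ℝ) : wedge f (r • g) = r * wedge f g := by
  simp only [wedge_eq_inner, real_inner_smul_right]

theorem wedge_sub_left (f g h : H) : wedge (f - g) h = wedge f h - wedge g h := by
  rw [wedge_antisymm, wedge_sub_right, wedge_antisymm h f, wedge_antisymm h g]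
  ring

theorem wedge_smul_left (f g : H) (r : ℝ) : wedge (r • f) g = r * wedge f g := by
  rw [wedge_antisymm, wedge_smul_right, wedge_antisymm g f, mul_neg, neg_neg]

theorem wedge_toH (w u : ℝ →ᵇ ℂ) :
    wedge (toH w) (toH u) = ∫ t, (conj (w t) * u t).im ∂unitMeasure := by
  rw [wedge_eq_integral]
  refine integral_congr_ae ?_
  filter_upwards [pot_toH w, pot_toH u] with t hw hu
  rw [hw, hu]

/-- With `A = Im (z̄ₐ z_c)` and `B = Im (z̄_b z_d)`, the integrand of the wedge product is
`(A B)' / (m - l)`. -/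
theorem wedge_sol (v : H) (l m : ℝ) (a b c d : ℂ) :
    (m - l) * wedge (toH (sol a (v, l) * sol b (v, l))) (toH (sol c (v, m) * sol d (v, m))) =
      (conj (sol a (v, l) 1) * sol c (v, m) 1).im * (conj (sol b (v, l) 1) * sol d (v, m) 1).im -
      (conj a * c).im * (conj b * d).im := by
  have him (a c : ℂ) : IsPrimitive (fun x => (conj (sol a (v, l) x) * sol c (v, m) x).im)
      (fun t => (m - l) * (conj (sol a (v, l) t) * sol c (v, m) t).re) := by
    simpa using (isPrimitive_sol a (v, l)).im_conj_mul (h := 0)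
      (by simpa using isPrimitive_sol c (v, m))
  have h := ((him a c).mul (him b d)).apply_one
  simp only [sol_zero] at h
  rw [h, add_sub_cancel_left, wedge_toH, ← integral_const_mul]
  refine integral_congr_ae (Eventually.of_forall fun t => ?_)
  simp only [BoundedContinuousFunction.mul_apply, map_mul, Complex.mul_im, Complex.mul_re,
    Complex.conj_re, Complex.conj_im]
  ring

theorem im_conj_sol_level {c c' : ℝ} (hs : Real.sin (c' - c) = 0) (v : H) :
    (conj (sol 1 (v, level c v) 1) * sol 1 (v, level c' v) 1).im = 0 := by
  rw [sol_one_apply_one (v, level c v), sol_one_apply_one (v, level c' v), angle_level, angle_level,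
    Complex.exp_mul_I, Complex.exp_mul_I]
  rw [Real.sin_sub] at hs
  simp only [← Complex.ofReal_cos, ← Complex.ofReal_sin, Complex.mul_im, Complex.mul_re,
    Complex.conj_re, Complex.conj_im, Complex.add_re, Complex.add_im, Complex.ofReal_re,
    Complex.ofReal_im, Complex.I_re, Complex.I_im]
  linear_combination ‖sol 1 (v, level c v) 1‖ * ‖sol 1 (v, level c' v) 1‖ * hs

theorem wedge_sol_level {c c' : ℝ} (hcc : c ≠ c') (hs : Real.sin (c' - c) = 0) (v : H) (b d : ℂ) :
    wedge (toH (sol 1 (v, level c v) * sol b (v, level c v)))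
      (toH (sol 1 (v, level c' v) * sol d (v, level c' v))) = 0 := by
  have h := wedge_sol v (level c v) (level c' v) 1 b 1 d
  rw [im_conj_sol_level hs] at h
  simp only [zero_mul, map_one, mul_one, Complex.one_im, sub_self, mul_eq_zero] at h
  refine h.resolve_left fun hlevel => hcc ?_
  rw [← angle_level c v, ← angle_level c' v, sub_eq_zero.1 hlevel]

theorem wedge_sol_self (p : H × ℝ) :
    wedge (toH (sol 1 p * sol Complex.I p)) (toH (sol 1 p * sol 1 p)) = -solNormSq p := by
  rw [wedge_toH, solNormSq, ← integral_neg]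
  refine integral_congr_ae (Eventually.of_forall fun t => ?_)
  have hwronskian := im_conj_sol_one_mul_sol_I p t
  simp only [← Complex.normSq_eq_norm_sq, Complex.normSq_apply, Complex.mul_im, Complex.mul_re,
    Complex.conj_re, Complex.conj_im, BoundedContinuousFunction.mul_apply, map_mul]
    at hwronskian ⊢
  linear_combination -((sol 1 p t).re * (sol 1 p t).re + (sol 1 p t).im * (sol 1 p t).im) *
    hwronskian

theorem wedge_levelGrad_levelGrad {c c' : ℝ} (hs : Real.sin (c' - c) = 0) (v : H) :
    wedge (levelGrad c v) (levelGrad c' v) = 0 := by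
  rcases eq_or_ne c c' with rfl | hcc
  · exact wedge_self _
  · rw [levelGrad, levelGrad, wedge_smul_left, wedge_smul_right, wedge_sol_level hcc hs,
      mul_zero, mul_zero]

theorem wedge_normingGrad_levelGrad {c c' : ℝ} (hs : Real.sin (c' - c) = 0) (v : H) :
    wedge (normingGrad c v) (levelGrad c' v) = if c = c' then 1 else 0 := by
  rw [normingGrad, wedge_sub_left, wedge_smul_left, wedge_levelGrad_levelGrad hs, mul_zero,
    zero_sub, levelGrad, wedge_smul_right]
  split_ifs with hcc
  · rw [← hcc, wedge_sol_self, mul_neg, neg_neg, inv_mul_cancel₀ (solNormSq_pos _).ne']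
  · rw [wedge_sol_level hcc hs, mul_zero, neg_zero]

theorem wedge_normingGrad_normingGrad {c c' : ℝ} (hs : Real.sin (c' - c) = 0) (v : H) :
    wedge (normingGrad c v) (normingGrad c' v) = 0 := by
  rcases eq_or_ne c c' with rfl | hcc
  · exact wedge_self _
  · simp [normingGrad, levelGrad, wedge_sub_left, wedge_smul_left, wedge_sub_right,
      wedge_smul_right, wedge_sol_level hcc hs]

end Symplectic

/-! ### Oscillatory integrals of the potential -/

section Oscillation

/-- The exponential `x ↦ e^{icx}`, as a bounded function. -/
def planeWave (c : ℝ) : ℝ →ᵇ ℂ :=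
  BoundedContinuousFunction.ofNormedAddCommGroup (fun x => Complex.exp (Complex.I * (c * x : ℝ)))
    (by fun_prop) 1 fun x => (Complex.norm_exp_I_mul_ofReal _).le

theorem planeWave_apply (c x : ℝ) : planeWave c x = Complex.exp (Complex.I * (c * x : ℝ)) := rfl

theorem norm_planeWave (c x : ℝ) : ‖planeWave c x‖ = 1 := Complex.norm_exp_I_mul_ofReal _

theorem planeWave_apply_zero (c : ℝ) : planeWave c 0 = 1 := by simp [planeWave_apply]

theorem planeWave_add (c d x : ℝ) : planeWave (c + d) x = planeWave c x * planeWave d x := by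
  simp only [planeWave_apply, ← Complex.exp_add, ← mul_add, ← Complex.ofReal_add, add_mul]

theorem conj_planeWave (c x : ℝ) : conj (planeWave c x) = planeWave (-c) x := by
  simp [planeWave_apply, ← Complex.exp_conj]

theorem planeWave_mul_planeWave_neg (c x : ℝ) : planeWave c x * planeWave (-c) x = 1 := by
  rw [← planeWave_add, add_neg_cancel]
  simp [planeWave_apply]

theorem isPrimitive_planeWave (c : ℝ) :
    IsPrimitive (planeWave c) (fun t => Complex.I * c * planeWave c t) := by
  refine ((IsPrimitive.ofReal.const_mul (Complex.I * c)).cexp).congr (fun x _ => ?_)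
    (Eventually.of_forall fun t => ?_) <;>
  simp [planeWave_apply, mul_assoc]

theorem norm_planeWave_sub_planeWave_le (l c : ℝ) {x : ℝ} (hx : x ∈ Icc (0 : ℝ) 1) :
    ‖planeWave l x - planeWave c x‖ ≤ |l - c| := by
  calc ‖planeWave l x - planeWave c x‖
      = ‖planeWave c x * (planeWave (l - c) x - 1)‖ := by
        rw [mul_sub_one, ← planeWave_add, add_sub_cancel]
    _ ≤ ‖(l - c) * x‖ := by
        rw [norm_mul, norm_planeWave, one_mul]
        exact Real.norm_exp_I_mul_ofReal_sub_one_le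
    _ ≤ |l - c| := by
        rw [Real.norm_eq_abs, abs_mul, abs_of_nonneg hx.1]
        exact mul_le_of_le_one_right (abs_nonneg _) hx.2

/-- `∫₀ˣ v(t) e^{-2ilt} dt`. -/
def osc (v : H) (l : ℝ) : ℝ →ᵇ ℂ :=
  primitive (fun t => pot v t * planeWave (-2 * l) t)
    (integrable_mul_boundedContinuousFunction (integrable_pot v) _)

theorem osc_zero (v : H) (l : ℝ) : osc v l 0 = 0 := by
  simp [osc, primitive_apply, clamp_zero]

theorem isPrimitive_osc (v : H) (l : ℝ) :
    IsPrimitive (osc v l) (fun t => pot v t * planeWave (-2 * l) t) :=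
  isPrimitive_primitive _

theorem norm_osc_neg (v : H) (l x : ℝ) : ‖osc (-v) l x‖ = ‖osc v l x‖ := by
  rw [← norm_neg, osc, osc, primitive_apply, primitive_apply, ← intervalIntegral.integral_neg]
  congr 1
  refine intervalIntegral_congr_ae_unitMeasure ?_ (clamp_mem x)
  filter_upwards [pot_neg v] with t ht
  rw [ht, neg_mul, neg_neg]

/-- The `L²` norm of `osc`. -/
def oscNorm (v : H) (l : ℝ) : ℝ := √(∫ t, ‖osc v l t‖ ^ 2 ∂unitMeasure)

theorem oscNorm_nonneg (v : H) (l : ℝ) : 0 ≤ oscNorm v l := Real.sqrt_nonneg _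

theorem oscNorm_sq (v : H) (l : ℝ) : oscNorm v l ^ 2 = ∫ t, ‖osc v l t‖ ^ 2 ∂unitMeasure :=
  Real.sq_sqrt (integral_nonneg fun _ => sq_nonneg _)

theorem integral_norm_osc_le (v : H) (l : ℝ) : ∫ t, ‖osc v l t‖ ∂unitMeasure ≤ oscNorm v l := by
  simpa [oscNorm] using integral_norm_mul_norm_le (memLp_boundedContinuousFunction (osc v l))
    (memLp_const (1 : ℂ))

/-- The pointwise size of the perturbation caused by `v` at the spectral parameter `l`. -/
def oscSize (v : H) (l x : ℝ) : ℝ := ‖osc v l x‖ + oscNorm v l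

theorem oscSize_nonneg (v : H) (l x : ℝ) : 0 ≤ oscSize v l x :=
  add_nonneg (norm_nonneg _) (oscNorm_nonneg _ _)

theorem norm_osc_le_oscSize (v : H) (l x : ℝ) : ‖osc v l x‖ ≤ oscSize v l x :=
  le_add_of_nonneg_right (oscNorm_nonneg _ _)

theorem oscNorm_le_oscSize (v : H) (l x : ℝ) : oscNorm v l ≤ oscSize v l x :=
  le_add_of_nonneg_left (norm_nonneg _)

theorem oscSize_neg (v : H) (l x : ℝ) : oscSize (-v) l x = oscSize v l x := by
  simp only [oscSize, oscNorm, norm_osc_neg]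

theorem integrable_norm_pot_mul_oscSize (v : H) (l : ℝ) :
    Integrable (fun t => ‖pot v t‖ * oscSize v l t) unitMeasure :=
  (memLp_pot v).norm.integrable_mul
    ((memLp_boundedContinuousFunction (osc v l)).norm.add (memLp_const _))

theorem integral_norm_pot_mul_oscSize_le (v : H) (l : ℝ) :
    ∫ t, ‖pot v t‖ * oscSize v l t ∂unitMeasure ≤ 2 * ‖v‖ * oscNorm v l := by
  have hint : Integrable (fun t => ‖pot v t‖ * ‖osc v l t‖) unitMeasure :=
    (memLp_pot v).norm.integrable_mul (memLp_boundedContinuousFunction (osc v l)).norm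
  have hosc := integral_norm_pot_mul_le v (memLp_boundedContinuousFunction (osc v l))
  simp only [oscSize, mul_add]
  rw [integral_add hint ((integrable_pot v).norm.mul_const _), integral_mul_const]
  calc _ ≤ ‖v‖ * oscNorm v l + ‖v‖ * oscNorm v l :=
        add_le_add hosc (mul_le_mul_of_nonneg_right (integral_norm_pot_le v) (oscNorm_nonneg v l))
    _ = 2 * ‖v‖ * oscNorm v l := by ring

theorem isPrimitive_osc_mul_planeWave_sub (v : H) (c d : ℝ) :
    IsPrimitive (fun x => osc v c x * planeWave (-2 * d) x - osc v (c + d) x)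
      (fun t => osc v c t * (Complex.I * ↑(-2 * d) * planeWave (-2 * d) t)) := by
  refine (((isPrimitive_osc v c).mul (isPrimitive_planeWave (-2 * d))).sub
    (isPrimitive_osc v (c + d))).congr (fun _ _ => rfl) (Eventually.of_forall fun t => ?_)
  simp only [mul_add (-2 : ℝ) c d, planeWave_add]
  ring

theorem norm_osc_add_le (v : H) (c d : ℝ) {x : ℝ} (hx : x ∈ Icc (0 : ℝ) 1) :
    ‖osc v (c + d) x‖ ≤ ‖osc v c x‖ + 2 * |d| * oscNorm v c := by
  have hsub := (isPrimitive_osc_mul_planeWave_sub v c d).norm_sub_le hx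
  simp only [osc_zero, zero_mul, sub_zero, norm_mul, norm_planeWave, Complex.norm_I,
    Complex.norm_real, norm_neg, Real.norm_ofNat, Real.norm_eq_abs d, one_mul, mul_one] at hsub
  rw [integral_mul_const] at hsub
  calc ‖osc v (c + d) x‖
      ≤ ‖osc v c x * planeWave (-2 * d) x‖
        + ‖osc v c x * planeWave (-2 * d) x - osc v (c + d) x‖ := norm_le_norm_add_norm_sub _ _
    _ ≤ ‖osc v c x‖ + oscNorm v c * (2 * |d|) := by
        rw [norm_mul, norm_planeWave, mul_one]
        gcongr
        exact hsub.trans (by gcongr; exact integral_norm_osc_le v c)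
    _ = ‖osc v c x‖ + 2 * |d| * oscNorm v c := by ring

theorem oscNorm_add_le (v : H) (c d : ℝ) : oscNorm v (c + d) ≤ (2 + 3 * |d|) * oscNorm v c := by
  have hosc := (memLp_boundedContinuousFunction (osc v c)).norm.integrable_sq
  refine (Real.sqrt_le_left (by have := oscNorm_nonneg v c; positivity)).2 ?_
  calc ∫ t, ‖osc v (c + d) t‖ ^ 2 ∂unitMeasure
      ≤ ∫ t, (2 * ‖osc v c t‖ ^ 2 + 2 * (2 * |d| * oscNorm v c) ^ 2) ∂unitMeasure := by
        refine integral_mono_ae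
          (memLp_boundedContinuousFunction (osc v (c + d))).norm.integrable_sq
          ((hosc.const_mul 2).add (integrable_const _)) ?_
        refine (ae_restrict_mem measurableSet_Ioo).mono fun t ht => ?_
        beta_reduce
        rw [← mul_add]
        exact (pow_le_pow_left₀ (norm_nonneg _)
          (norm_osc_add_le v c d (Ioo_subset_Icc_self ht)) 2).trans add_sq_le
    _ = 2 * oscNorm v c ^ 2 + 2 * (2 * |d| * oscNorm v c) ^ 2 := by
        rw [integral_add (hosc.const_mul 2) (integrable_const _), integral_const_mul, ← oscNorm_sq]
        simp
    _ ≤ ((2 + 3 * |d|) * oscNorm v c) ^ 2 := by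
        have : 0 ≤ |d| * oscNorm v c ^ 2 := by positivity
        nlinarith [sq_nonneg (|d| * oscNorm v c), sq_nonneg (oscNorm v c)]

theorem oscSize_le_mul_oscSize (v : H) {l c B x : ℝ} (hB : |l - c| ≤ B) (hx : x ∈ Icc (0 : ℝ) 1) :
    oscSize v l x ≤ (3 + 5 * B) * oscSize v c x := by
  have hpoint := norm_osc_add_le v c (l - c) hx
  have hnorm := oscNorm_add_le v c (l - c)
  rw [add_sub_cancel] at hpoint hnorm
  calc oscSize v l x
      ≤ ‖osc v c x‖ + 2 * |l - c| * oscNorm v c + (2 + 3 * |l - c|) * oscNorm v c :=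
        add_le_add hpoint hnorm
    _ ≤ oscSize v c x + 2 * B * oscSize v c x + (2 + 3 * B) * oscSize v c x := by
        have := oscNorm_nonneg v c
        have hB0 : 0 ≤ B := (abs_nonneg _).trans hB
        gcongr
        exacts [norm_osc_le_oscSize v c x, oscNorm_le_oscSize v c x, oscNorm_le_oscSize v c x]
    _ = (3 + 5 * B) * oscSize v c x := by ring

end Oscillation

/-! ### Asymptotics of the solutions -/

section Asymptotics

/-- The solution with `z(0) = 1` relative to the free solution: `e^{-ilx} z(x)`. -/
def amplitude (v : H) (l : ℝ) : ℝ →ᵇ ℂ := planeWave (-l) * sol 1 (v, l)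

theorem amplitude_apply (v : H) (l x : ℝ) :
    amplitude v l x = planeWave (-l) x * sol 1 (v, l) x := rfl

theorem norm_amplitude (v : H) (l x : ℝ) : ‖amplitude v l x‖ = ‖sol 1 (v, l) x‖ := by
  rw [amplitude_apply, norm_mul, norm_planeWave, one_mul]

theorem isPrimitive_amplitude (v : H) (l : ℝ) : IsPrimitive (amplitude v l) (fun t =>
    -Complex.I * (pot v t * planeWave (-2 * l) t) * conj (amplitude v l t)) := by
  refine ((isPrimitive_planeWave (-l)).mul (isPrimitive_sol 1 (v, l))).congr (fun _ _ => rfl)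
    (Eventually.of_forall fun t => ?_)
  have hwave : planeWave (-2 * l) t * planeWave l t = planeWave (-l) t := by
    rw [← planeWave_add]
    ring_nf
  simp only [rhs, amplitude_apply, map_mul, conj_planeWave, neg_neg, Complex.ofReal_neg]
  linear_combination (-Complex.I * pot v t * conj (sol 1 (v, l) t)) * hwave

/-- The integration by parts behind the asymptotics: the forcing term `-i v e^{-2ilx} ζ̄` of the
amplitude `ζ` is the derivative of `-i osc ζ̄` up to terms of second order in `v`. -/
theorem isPrimitive_amplitude_add (v : H) (l : ℝ) :
    IsPrimitive (fun x => amplitude v l x + Complex.I * (osc v l x * conj (amplitude v l x)))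
      (fun t => -(osc v l t * conj (pot v t * planeWave (-2 * l) t) * amplitude v l t)) := by
  refine ((isPrimitive_amplitude v l).add (((isPrimitive_osc v l).mul
    (isPrimitive_amplitude v l).conjugate).const_mul Complex.I)).congr (fun _ _ => rfl)
    (Eventually.of_forall fun t => ?_)
  simp only [map_mul, map_neg, Complex.conj_I, Complex.conj_conj]
  linear_combination
    -(osc v l t * (conj (pot v t) * conj (planeWave (-2 * l) t)) * amplitude v l t) * Complex.I_sq

theorem norm_amplitude_sub_one_le (v : H) (l : ℝ) {x : ℝ} (hx : x ∈ Icc (0 : ℝ) 1) :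
    ‖amplitude v l x - 1‖ ≤ Real.exp ‖v‖ * (1 + ‖v‖) * oscSize v l x := by
  have hamp (t : ℝ) : ‖amplitude v l t‖ ≤ Real.exp ‖v‖ :=
    (norm_amplitude v l t).trans_le (norm_sol_one_le (v, l) t)
  have hparts := (isPrimitive_amplitude_add v l).norm_sub_le hx
  simp only [osc_zero, zero_mul, mul_zero, add_zero, amplitude_apply v l 0, planeWave_apply_zero,
    sol_zero, mul_one] at hparts
  have hremainder : ∫ t, ‖-(osc v l t * conj (pot v t * planeWave (-2 * l) t) * amplitude v l t)‖
      ∂unitMeasure ≤ Real.exp ‖v‖ * (‖v‖ * oscNorm v l) := by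
    calc _ ≤ ∫ t, Real.exp ‖v‖ * (‖pot v t‖ * ‖osc v l t‖) ∂unitMeasure := by
          refine integral_mono (isPrimitive_amplitude_add v l).integrable.norm
            (((memLp_pot v).norm.integrable_mul
              (memLp_boundedContinuousFunction (osc v l)).norm).const_mul _) fun t => ?_
          simp only [norm_neg, norm_mul, RCLike.norm_conj, norm_planeWave, mul_one]
          rw [mul_comm, mul_comm ‖osc v l t‖]
          gcongr
          exact hamp t
      _ ≤ Real.exp ‖v‖ * (‖v‖ * oscNorm v l) := by
          rw [integral_const_mul]
          gcongr
          exact integral_norm_pot_mul_le v (memLp_boundedContinuousFunction (osc v l))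
  calc ‖amplitude v l x - 1‖
      = ‖(amplitude v l x + Complex.I * (osc v l x * conj (amplitude v l x)) - 1) -
          Complex.I * (osc v l x * conj (amplitude v l x))‖ := by
        congr 1
        ring
    _ ≤ Real.exp ‖v‖ * (‖v‖ * oscNorm v l) + ‖osc v l x‖ * Real.exp ‖v‖ := by
        refine (norm_sub_le _ _).trans (add_le_add (hparts.trans hremainder) ?_)
        rw [norm_mul, norm_mul, Complex.norm_I, one_mul, RCLike.norm_conj]
        gcongr
        exact hamp x
    _ ≤ Real.exp ‖v‖ * (‖v‖ * oscSize v l x) + oscSize v l x * Real.exp ‖v‖ := by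
        gcongr
        exacts [oscNorm_le_oscSize v l x, norm_osc_le_oscSize v l x]
    _ = Real.exp ‖v‖ * (1 + ‖v‖) * oscSize v l x := by ring

theorem norm_sol_sub_planeWave_le (v : H) {l c B x : ℝ} (hB : |l - c| ≤ B)
    (hx : x ∈ Icc (0 : ℝ) 1) : ‖sol 1 (v, l) x - planeWave c x‖ ≤
      Real.exp ‖v‖ * (1 + ‖v‖) * (3 + 5 * B) * oscSize v c x + |l - c| := by
  have hsol : sol 1 (v, l) x = planeWave l x * amplitude v l x := by
    rw [amplitude_apply, ← mul_assoc, planeWave_mul_planeWave_neg, one_mul]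
  calc ‖sol 1 (v, l) x - planeWave c x‖
      = ‖planeWave l x * (amplitude v l x - 1) + (planeWave l x - planeWave c x)‖ := by
        rw [hsol]
        congr 1
        ring
    _ ≤ ‖amplitude v l x - 1‖ + |l - c| := by
        refine (norm_add_le _ _).trans
          (add_le_add (le_of_eq ?_) (norm_planeWave_sub_planeWave_le l c hx))
        rw [norm_mul, norm_planeWave, one_mul]
    _ ≤ Real.exp ‖v‖ * (1 + ‖v‖) * ((3 + 5 * B) * oscSize v c x) + |l - c| := by
        gcongr
        exact (norm_amplitude_sub_one_le v l hx).trans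
          (by gcongr; exact oscSize_le_mul_oscSize v hB hx)
    _ = Real.exp ‖v‖ * (1 + ‖v‖) * (3 + 5 * B) * oscSize v c x + |l - c| := by ring

theorem isPrimitive_volterra_phase_add (v : H) (l : ℝ) :
    IsPrimitive (fun x => volterra (v, 0) (phase (v, l)) x + Complex.I * osc v l x)
      (fun t => Complex.I * (pot v t * planeWave (-2 * l) t) *
        ((amplitude v l t - 1) - conj (amplitude v l t - 1)) * (amplitude v l t)⁻¹) := by
  refine ((isPrimitive_volterra (v, 0) (phase (v, l))).add
    ((isPrimitive_osc v l).const_mul Complex.I)).congr (fun _ _ => rfl)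
    (Eventually.of_forall fun t => ?_)
  have hsol := sol_one_ne_zero (v, l) t
  have hconj : conj (sol 1 (v, l) t) ≠ 0 := (map_ne_zero _).2 hsol
  have hinv : planeWave l t = (planeWave (-l) t)⁻¹ :=
    eq_inv_of_mul_eq_one_left (planeWave_mul_planeWave_neg l t)
  have hne : planeWave (-l) t ≠ 0 := norm_ne_zero_iff.1 (by rw [norm_planeWave]; exact one_ne_zero)
  have hsq : planeWave (-2 * l) t = planeWave (-l) t * planeWave (-l) t := by
    rw [← planeWave_add]
    ring_nf
  simp only [rhs, phase_apply, amplitude_apply, map_mul, map_sub, map_one, map_inv₀,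
    Complex.conj_conj, conj_planeWave, neg_neg, hinv, hsq, Complex.ofReal_zero]
  field_simp
  ring

theorem norm_volterra_phase_add_le (v : H) (l : ℝ) :
    ‖volterra (v, 0) (phase (v, l)) 1 + Complex.I * osc v l 1‖ ≤
      4 * ‖v‖ * (1 + ‖v‖) * Real.exp ‖v‖ ^ 2 * oscNorm v l := by
  have hprim := isPrimitive_volterra_phase_add v l
  have hsum := hprim.norm_sub_le (right_mem_Icc.2 zero_le_one)
  simp only [volterra_zero, osc_zero, mul_zero, add_zero, sub_zero] at hsum
  have hinv (t : ℝ) : ‖(amplitude v l t)⁻¹‖ ≤ Real.exp ‖v‖ := by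
    rw [norm_inv, norm_amplitude, ← inv_inv (Real.exp ‖v‖), ← Real.exp_neg]
    gcongr
    exact exp_neg_le_norm_sol_one (v, l) t
  have hsub {t : ℝ} (ht : t ∈ Icc (0 : ℝ) 1) :
      ‖(amplitude v l t - 1) - conj (amplitude v l t - 1)‖ ≤
        2 * (Real.exp ‖v‖ * (1 + ‖v‖) * oscSize v l t) := by
    have hamp := norm_amplitude_sub_one_le v l ht
    refine (norm_sub_le _ _).trans ?_
    rw [RCLike.norm_conj, two_mul]
    exact add_le_add hamp hamp
  calc ‖volterra (v, 0) (phase (v, l)) 1 + Complex.I * osc v l 1‖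
      ≤ ∫ t, 2 * (1 + ‖v‖) * Real.exp ‖v‖ ^ 2 * (‖pot v t‖ * oscSize v l t) ∂unitMeasure := by
        refine hsum.trans (integral_mono_ae hprim.integrable.norm
          ((integrable_norm_pot_mul_oscSize v l).const_mul _)
          ((ae_restrict_mem measurableSet_Ioo).mono fun t ht => ?_))
        simp only [norm_mul, norm_planeWave, Complex.norm_I, mul_one, one_mul]
        calc _ ≤ ‖pot v t‖ * (2 * (Real.exp ‖v‖ * (1 + ‖v‖) * oscSize v l t)) * Real.exp ‖v‖ := by
              gcongr
              exacts [mul_nonneg (norm_nonneg _) ((norm_nonneg _).trans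
                (hsub (Ioo_subset_Icc_self ht))), hsub (Ioo_subset_Icc_self ht), hinv t]
          _ = 2 * (1 + ‖v‖) * Real.exp ‖v‖ ^ 2 * (‖pot v t‖ * oscSize v l t) := by ring
    _ ≤ 2 * (1 + ‖v‖) * Real.exp ‖v‖ ^ 2 * (2 * ‖v‖ * oscNorm v l) := by
        rw [integral_const_mul]
        gcongr
        exact integral_norm_pot_mul_oscSize_le v l
    _ = 4 * ‖v‖ * (1 + ‖v‖) * Real.exp ‖v‖ ^ 2 * oscNorm v l := by ring

theorem abs_angle_sub_le_oscSize (v : H) (l : ℝ) : |angle (v, l) - l| ≤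
    (1 + 4 * ‖v‖ * (1 + ‖v‖) * Real.exp ‖v‖ ^ 2) * oscSize v l 1 := by
  have hangle : angle (v, l) - l = (volterra (v, 0) (phase (v, l)) 1).im := by
    simp [angle, logSol]
  calc |angle (v, l) - l| ≤ ‖volterra (v, 0) (phase (v, l)) 1‖ :=
        hangle ▸ Complex.abs_im_le_norm _
    _ = ‖(volterra (v, 0) (phase (v, l)) 1 + Complex.I * osc v l 1) - Complex.I * osc v l 1‖ := by
        rw [add_sub_cancel_right]
    _ ≤ 4 * ‖v‖ * (1 + ‖v‖) * Real.exp ‖v‖ ^ 2 * oscNorm v l + ‖osc v l 1‖ := by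
        refine (norm_sub_le _ _).trans
          (add_le_add (norm_volterra_phase_add_le v l) (le_of_eq ?_))
        rw [norm_mul, Complex.norm_I, one_mul]
    _ ≤ 4 * ‖v‖ * (1 + ‖v‖) * Real.exp ‖v‖ ^ 2 * oscSize v l 1 + oscSize v l 1 := by
        gcongr
        exacts [oscNorm_le_oscSize v l 1, norm_osc_le_oscSize v l 1]
    _ = (1 + 4 * ‖v‖ * (1 + ‖v‖) * Real.exp ‖v‖ ^ 2) * oscSize v l 1 := by ring

theorem abs_level_sub_le (v : H) (c : ℝ) : |level c v - c| ≤ ‖v‖ := by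
  simpa only [angle_level, abs_sub_comm] using abs_angle_sub_le (v, level c v)

theorem exists_abs_level_sub_le (v : H) :
    ∃ K, 0 ≤ K ∧ ∀ c, |level c v - c| ≤ K * oscSize v c 1 := by
  refine ⟨(1 + 4 * ‖v‖ * (1 + ‖v‖) * Real.exp ‖v‖ ^ 2) * (3 + 5 * ‖v‖), by positivity, fun c => ?_⟩
  have h := abs_angle_sub_le_oscSize v (level c v)
  rw [angle_level, abs_sub_comm] at h
  rw [mul_assoc]
  refine h.trans ?_
  gcongr
  exact oscSize_le_mul_oscSize v (abs_level_sub_le v c) (right_mem_Icc.2 zero_le_one)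

/-- The pointwise error of the solutions at `level c v`: the second summand accounts for the
distance of `level c v` from `c`. -/
def oscMajorant (v : H) (c x : ℝ) : ℝ := oscSize v c x + oscSize v c 1

theorem exists_norm_sol_level_sub_le (v : H) : ∃ K, 0 ≤ K ∧ ∀ c : ℝ, ∀ x ∈ Icc (0 : ℝ) 1,
    ‖sol 1 (v, level c v) x - planeWave c x‖ ≤ K * oscMajorant v c x ∧
    ‖sol Complex.I (v, level c v) x - Complex.I * planeWave c x‖ ≤ K * oscMajorant v c x := by
  obtain ⟨K, hK, hlevel⟩ := exists_abs_level_sub_le v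
  have hsum {c x A : ℝ} (hA : 0 ≤ A) : A * oscSize v c x + |level c v - c| ≤
      (A + K) * oscMajorant v c x := by
    have hx := oscSize_nonneg v c x
    have h1 := oscSize_nonneg v c 1
    rw [oscMajorant]
    nlinarith [hlevel c, mul_nonneg hA h1, mul_nonneg hK hx]
  refine ⟨Real.exp ‖v‖ * (1 + ‖v‖) * (3 + 5 * ‖v‖) + K, by positivity, fun c x hx => ⟨?_, ?_⟩⟩
  · exact (norm_sol_sub_planeWave_le v (abs_level_sub_le v c) hx).trans (hsum (by positivity))
  · rw [sol_I, BoundedContinuousFunction.smul_apply, smul_eq_mul, ← mul_sub, norm_mul,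
      Complex.norm_I, one_mul]
    refine (norm_sol_sub_planeWave_le (-v) (abs_level_sub_le v c) hx).trans ?_
    rw [norm_neg, oscSize_neg]
    exact hsum (by positivity)

end Asymptotics

/-! ### Asymptotics of the gradients -/

section Gradients

theorem norm_toH_sq (w : ℝ →ᵇ ℂ) : ‖toH w‖ ^ 2 = ∫ t, ‖w t‖ ^ 2 ∂unitMeasure := by
  rw [norm_sq_eq_integral]
  refine integral_congr_ae ?_
  filter_upwards [pot_toH w] with t ht
  rw [ht]

theorem norm_toH_le (w : ℝ →ᵇ ℂ) : ‖toH w‖ ≤ ‖w‖ := by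
  refine le_of_sq_le_sq ?_ (norm_nonneg w)
  calc ‖toH w‖ ^ 2 ≤ ∫ _, ‖w‖ ^ 2 ∂unitMeasure := by
        rw [norm_toH_sq]
        exact integral_mono (memLp_boundedContinuousFunction w).norm.integrable_sq
          (integrable_const _) fun t => pow_le_pow_left₀ (norm_nonneg _) (w.norm_coe_le_norm t) 2
    _ = ‖w‖ ^ 2 := by simp

theorem toH_sub (w u : ℝ →ᵇ ℂ) : toH (w - u) = toH w - toH u := by
  simp only [toH, WithLp.ext_iff]
  rfl

theorem integrable_oscMajorant (v : H) (c : ℝ) : Integrable (oscMajorant v c) unitMeasure :=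
  (((memLp_boundedContinuousFunction (osc v c)).integrable (by norm_num)).norm.add
    (integrable_const _)).add (integrable_const _)

theorem integral_oscMajorant_le (v : H) (c : ℝ) :
    ∫ t, oscMajorant v c t ∂unitMeasure ≤ 3 * oscSize v c 1 := by
  have hint := ((memLp_boundedContinuousFunction (osc v c)).integrable (by norm_num)).norm
  have hosc := integral_norm_osc_le v c
  have hsize := oscNorm_le_oscSize v c 1
  calc ∫ t, oscMajorant v c t ∂unitMeasure
      = ∫ t, (‖osc v c t‖ + (oscNorm v c + oscSize v c 1)) ∂unitMeasure := by
        simp only [oscMajorant, oscSize, add_assoc]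
    _ = ∫ t, ‖osc v c t‖ ∂unitMeasure + (oscNorm v c + oscSize v c 1) := by
        rw [integral_add hint (integrable_const _)]
        simp
    _ ≤ 3 * oscSize v c 1 := by linarith

theorem integral_oscMajorant_sq_le (v : H) (c : ℝ) :
    ∫ t, oscMajorant v c t ^ 2 ∂unitMeasure ≤ (4 * oscSize v c 1) ^ 2 := by
  have hosc := (memLp_boundedContinuousFunction (osc v c)).norm
  have hnonneg := oscNorm_nonneg v c
  have hsize := oscNorm_le_oscSize v c 1
  calc ∫ t, oscMajorant v c t ^ 2 ∂unitMeasure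
      ≤ ∫ t, (2 * ‖osc v c t‖ ^ 2 + 2 * (2 * oscSize v c 1) ^ 2) ∂unitMeasure := by
        refine integral_mono
          ((hosc.add (memLp_const _)).add (memLp_const _)).integrable_sq
          ((hosc.integrable_sq.const_mul 2).add (integrable_const _)) fun t => ?_
        beta_reduce
        rw [← mul_add]
        refine (pow_le_pow_left₀ ?_ ?_ 2).trans add_sq_le
        · exact add_nonneg (oscSize_nonneg v c t) (oscSize_nonneg v c 1)
        · rw [oscMajorant, oscSize]
          linarith
    _ = 2 * oscNorm v c ^ 2 + 2 * (2 * oscSize v c 1) ^ 2 := by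
        rw [integral_add (hosc.integrable_sq.const_mul 2) (integrable_const _),
          integral_const_mul, ← oscNorm_sq]
        simp
    _ ≤ (4 * oscSize v c 1) ^ 2 := by nlinarith [pow_le_pow_left₀ hnonneg hsize 2]

theorem norm_toH_sub_le {v : H} {c K : ℝ} (hK : 0 ≤ K) {w u : ℝ →ᵇ ℂ}
    (h : ∀ x ∈ Icc (0 : ℝ) 1, ‖w x - u x‖ ≤ K * oscMajorant v c x) :
    ‖toH w - toH u‖ ≤ 4 * K * oscSize v c 1 := by
  have hsq : Integrable (fun t => oscMajorant v c t ^ 2) unitMeasure :=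
    (((memLp_boundedContinuousFunction (osc v c)).norm.add (memLp_const _)).add
      (memLp_const _)).integrable_sq
  refine le_of_sq_le_sq ?_ (mul_nonneg (by positivity) (oscSize_nonneg v c 1))
  calc ‖toH w - toH u‖ ^ 2 = ∫ t, ‖(w - u) t‖ ^ 2 ∂unitMeasure := by
        rw [← toH_sub, norm_toH_sq]
    _ ≤ ∫ t, K ^ 2 * oscMajorant v c t ^ 2 ∂unitMeasure := by
        refine integral_mono_ae (memLp_boundedContinuousFunction (w - u)).norm.integrable_sq
          (hsq.const_mul _) ((ae_restrict_mem measurableSet_Ioo).mono fun t ht => ?_)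
        beta_reduce
        rw [← mul_pow]
        exact pow_le_pow_left₀ (norm_nonneg _) (h t (Ioo_subset_Icc_self ht)) 2
    _ ≤ K ^ 2 * (4 * oscSize v c 1) ^ 2 := by
        rw [integral_const_mul]
        exact mul_le_mul_of_nonneg_left (integral_oscMajorant_sq_le v c) (sq_nonneg K)
    _ = (4 * K * oscSize v c 1) ^ 2 := by ring

theorem abs_integral_le_mul_oscSize {v : H} {c K : ℝ} (hK : 0 ≤ K) {f : ℝ → ℝ}
    (h : ∀ x ∈ Icc (0 : ℝ) 1, |f x| ≤ K * oscMajorant v c x) :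
    |∫ t, f t ∂unitMeasure| ≤ 3 * K * oscSize v c 1 := by
  rw [← Real.norm_eq_abs]
  calc ‖∫ t, f t ∂unitMeasure‖ ≤ ∫ t, K * oscMajorant v c t ∂unitMeasure :=
        norm_integral_le_of_norm_le ((integrable_oscMajorant v c).const_mul K)
          ((ae_restrict_mem measurableSet_Ioo).mono fun t ht => h t (Ioo_subset_Icc_self ht))
    _ ≤ K * (3 * oscSize v c 1) := by
        rw [integral_const_mul]
        exact mul_le_mul_of_nonneg_left (integral_oscMajorant_le v c) hK
    _ = 3 * K * oscSize v c 1 := by ring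

theorem norm_mul_sub_mul_le {R : Type*} [NormedRing R] {a b a₀ b₀ : R} {M d : ℝ} (ha : ‖a‖ ≤ M)
    (hb₀ : ‖b₀‖ ≤ 1) (had : ‖a - a₀‖ ≤ d) (hbd : ‖b - b₀‖ ≤ d) :
    ‖a * b - a₀ * b₀‖ ≤ (M + 1) * d := by
  have hM : 0 ≤ M := (norm_nonneg a).trans ha
  have hd : 0 ≤ d := (norm_nonneg _).trans had
  calc ‖a * b - a₀ * b₀‖ = ‖a * (b - b₀) + (a - a₀) * b₀‖ := by
        rw [mul_sub, sub_mul, sub_add_sub_cancel]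
    _ ≤ M * d + d * 1 := (norm_add_le _ _).trans (add_le_add
        ((norm_mul_le _ _).trans (mul_le_mul ha hbd (norm_nonneg _) hM))
        ((norm_mul_le _ _).trans (mul_le_mul had hb₀ (norm_nonneg _) hd)))
    _ = (M + 1) * d := by ring

theorem exists_norm_sol_mul_sol_sub_le (v : H) : ∃ K, 0 ≤ K ∧ ∀ c : ℝ, ∀ x ∈ Icc (0 : ℝ) 1,
    ‖sol 1 (v, level c v) x * sol 1 (v, level c v) x - planeWave (2 * c) x‖ ≤
      K * oscMajorant v c x ∧
    ‖sol 1 (v, level c v) x * sol Complex.I (v, level c v) x - Complex.I * planeWave (2 * c) x‖ ≤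
      K * oscMajorant v c x ∧
    |(conj (sol Complex.I (v, level c v) x) * sol 1 (v, level c v) x).re| ≤
      K * oscMajorant v c x := by
  obtain ⟨K, hK, hsol⟩ := exists_norm_sol_level_sub_le v
  refine ⟨(Real.exp ‖v‖ + 1) * K, by positivity, fun c x hx => ?_⟩
  obtain ⟨hone, hI⟩ := hsol c x hx
  have hle : ‖sol 1 (v, level c v) x‖ ≤ Real.exp ‖v‖ := norm_sol_one_le (v, level c v) x
  have hIwave : ‖Complex.I * planeWave c x‖ = 1 := by
    rw [norm_mul, Complex.norm_I, norm_planeWave, one_mul]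
  have hconj : ‖conj (sol Complex.I (v, level c v) x) - conj (Complex.I * planeWave c x)‖ ≤
      K * oscMajorant v c x := by
    rwa [← map_sub, RCLike.norm_conj]
  have hwave := planeWave_mul_planeWave_neg c x
  rw [two_mul, planeWave_add, mul_assoc]
  refine ⟨norm_mul_sub_mul_le hle (norm_planeWave c x).le hone hone, ?_, ?_⟩
  · rw [mul_left_comm]
    exact norm_mul_sub_mul_le hle hIwave.le hone hI
  · have hmul := norm_mul_sub_mul_le hle ((RCLike.norm_conj _).trans hIwave).le hone hconj
    have hfree : planeWave c x * conj (Complex.I * planeWave c x) = -Complex.I := by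
      rw [map_mul, Complex.conj_I, conj_planeWave]
      linear_combination -Complex.I * hwave
    rw [hfree] at hmul
    refine le_trans (le_of_eq ?_) ((Complex.abs_re_le_norm _).trans hmul)
    rw [mul_comm, Complex.sub_re, Complex.neg_re, Complex.I_re, neg_zero, sub_zero]

theorem exists_abs_solNormSq_sub_one_le (v : H) : ∃ K, 0 ≤ K ∧ ∀ c : ℝ,
    |solNormSq (v, level c v) - 1| ≤ K * oscSize v c 1 := by
  obtain ⟨K, hK, hsol⟩ := exists_norm_sol_mul_sol_sub_le v
  refine ⟨3 * K, by positivity, fun c => ?_⟩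
  have hsub : solNormSq (v, level c v) - 1 =
      ∫ t, (‖sol 1 (v, level c v) t‖ ^ 2 - 1) ∂unitMeasure := by
    rw [integral_sub (memLp_boundedContinuousFunction _).norm.integrable_sq (integrable_const _),
      solNormSq]
    simp
  rw [hsub]
  refine abs_integral_le_mul_oscSize hK fun x hx => (le_trans ?_ (hsol c x hx).1)
  simpa only [norm_mul, norm_planeWave, sq] using abs_norm_sub_norm_le
    (sol 1 (v, level c v) x * sol 1 (v, level c v) x) (planeWave (2 * c) x)

theorem inv_solNormSq_le (p : H × ℝ) : (solNormSq p)⁻¹ ≤ Real.exp ‖p.1‖ ^ 2 := by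
  rw [← inv_inv (Real.exp ‖p.1‖), ← Real.exp_neg, inv_pow]
  exact inv_anti₀ (by positivity) (exp_neg_sq_le_solNormSq p)

theorem norm_toH_planeWave (c : ℝ) : ‖toH (planeWave c)‖ = 1 := by
  rw [← sq_eq_sq₀ (norm_nonneg _) zero_le_one, norm_toH_sq]
  simp [norm_planeWave]

theorem exists_norm_levelGrad_sub_le (v : H) : ∃ K, 0 ≤ K ∧ ∀ c : ℝ,
    ‖levelGrad c v - toH (planeWave (2 * c))‖ ≤ K * oscSize v c 1 := by
  obtain ⟨K, hK, hsol⟩ := exists_norm_sol_mul_sol_sub_le v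
  obtain ⟨L, hL, hnormSq⟩ := exists_abs_solNormSq_sub_one_le v
  refine ⟨Real.exp ‖v‖ ^ 2 * (4 * K + L), by positivity, fun c => ?_⟩
  set p : H × ℝ := (v, level c v)
  have hpos := solNormSq_pos p
  have hsub : levelGrad c v - toH (planeWave (2 * c)) =
      (solNormSq p)⁻¹ • ((toH (sol 1 p * sol 1 p) - toH (planeWave (2 * c))) -
        (solNormSq p - 1) • toH (planeWave (2 * c))) := by
    rw [levelGrad, smul_sub, smul_sub, smul_smul, mul_sub, inv_mul_cancel₀ hpos.ne']
    module
  calc ‖levelGrad c v - toH (planeWave (2 * c))‖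
      ≤ (solNormSq p)⁻¹ * (‖toH (sol 1 p * sol 1 p) - toH (planeWave (2 * c))‖ +
          |solNormSq p - 1|) := by
        rw [hsub, norm_smul, Real.norm_of_nonneg (inv_nonneg.2 hpos.le)]
        refine mul_le_mul_of_nonneg_left ((norm_sub_le _ _).trans_eq ?_) (inv_nonneg.2 hpos.le)
        rw [norm_smul, norm_toH_planeWave, mul_one, Real.norm_eq_abs]
    _ ≤ Real.exp ‖v‖ ^ 2 * (4 * K * oscSize v c 1 + L * oscSize v c 1) := by
        gcongr
        exacts [inv_solNormSq_le p, norm_toH_sub_le hK fun x hx => (hsol c x hx).1, hnormSq c]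
    _ = Real.exp ‖v‖ ^ 2 * (4 * K + L) * oscSize v c 1 := by ring

theorem norm_levelGrad_le (c : ℝ) (v : H) : ‖levelGrad c v‖ ≤ Real.exp ‖v‖ ^ 4 := by
  have hsol : ‖sol 1 (v, level c v)‖ ≤ Real.exp ‖v‖ :=
    (BoundedContinuousFunction.norm_le (Real.exp_nonneg _)).2 (norm_sol_one_le (v, level c v))
  calc ‖levelGrad c v‖
      = (solNormSq (v, level c v))⁻¹ * ‖toH (sol 1 (v, level c v) * sol 1 (v, level c v))‖ := by
        rw [levelGrad, norm_smul, Real.norm_of_nonneg (inv_nonneg.2 (solNormSq_pos _).le)]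
    _ ≤ Real.exp ‖v‖ ^ 2 * (Real.exp ‖v‖ * Real.exp ‖v‖) := by
        gcongr
        · exact inv_solNormSq_le (v, level c v)
        · exact (norm_toH_le _).trans ((norm_mul_le _ _).trans (by gcongr))
    _ = Real.exp ‖v‖ ^ 4 := by ring

theorem exists_norm_normingGrad_sub_le (v : H) : ∃ K, 0 ≤ K ∧ ∀ c : ℝ,
    ‖normingGrad c v - -toH (Complex.I • planeWave (2 * c))‖ ≤ K * oscSize v c 1 := by
  obtain ⟨K, hK, hsol⟩ := exists_norm_sol_mul_sol_sub_le v
  refine ⟨3 * K * Real.exp ‖v‖ ^ 4 + 4 * K, by positivity, fun c => ?_⟩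
  have hcross : |solCross (v, level c v)| ≤ 3 * K * oscSize v c 1 :=
    abs_integral_le_mul_oscSize hK fun x hx => (hsol c x hx).2.2
  have hprod : ‖toH (sol 1 (v, level c v) * sol Complex.I (v, level c v)) -
      toH (Complex.I • planeWave (2 * c))‖ ≤ 4 * K * oscSize v c 1 :=
    norm_toH_sub_le hK fun x hx => (hsol c x hx).2.1
  calc ‖normingGrad c v - -toH (Complex.I • planeWave (2 * c))‖
      = ‖solCross (v, level c v) • levelGrad c v -
          (toH (sol 1 (v, level c v) * sol Complex.I (v, level c v)) -
            toH (Complex.I • planeWave (2 * c)))‖ := by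
        rw [normingGrad, sub_neg_eq_add, sub_add]
    _ ≤ 3 * K * oscSize v c 1 * Real.exp ‖v‖ ^ 4 + 4 * K * oscSize v c 1 := by
        refine (norm_sub_le _ _).trans (add_le_add ?_ hprod)
        rw [norm_smul]
        exact mul_le_mul hcross (norm_levelGrad_le c v) (norm_nonneg _)
          ((abs_nonneg _).trans hcross)
    _ = (3 * K * Real.exp ‖v‖ ^ 4 + 4 * K) * oscSize v c 1 := by ring

end Gradients

/-! ### Fourier series -/

section Fourier

/-- The eigenvalues `πn - b` of the system with zero potential. -/
def node (b : ℝ) (n : ℤ) : ℝ := Real.pi * n - b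

theorem hasSum_parseval (b : ℝ) {g : ℝ → ℂ} (hg : MemLp g 2 unitMeasure) :
    HasSum (fun n : ℤ => ‖∫ t, g t * planeWave (-2 * node b n) t ∂unitMeasure‖ ^ 2)
      (∫ t, ‖g t‖ ^ 2 ∂unitMeasure) := by
  have hmem : MemLp (fun t => planeWave (2 * b) t * g t) 2 unitMeasure := by
    refine hg.of_le ((planeWave (2 * b)).continuous.aestronglyMeasurable.mul hg.1)
      (Eventually.of_forall fun t => ?_)
    rw [norm_mul, norm_planeWave, one_mul]
  rw [unitMeasure, restrict_Ioo_eq_restrict_Ioc] at hmem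
  convert hasSum_sq_fourierCoeffOn zero_lt_one hmem using 1
  · ext n
    rw [fourierCoeffOn_eq_integral, integral_unitMeasure]
    simp only [sub_zero, div_one, one_smul]
    congr 2
    refine intervalIntegral.integral_congr fun t _ => ?_
    simp only [fourier_coe_apply, smul_eq_mul, planeWave_apply]
    rw [mul_comm, ← mul_assoc, ← Complex.exp_add]
    congr 2
    simp only [node]
    push_cast
    ring
  · simp only [integral_unitMeasure, sub_zero, inv_one, one_smul, norm_mul, norm_planeWave, one_mul]

theorem hasSum_norm_osc_sq (v : H) (b : ℝ) {x : ℝ} (hx : x ∈ Icc (0 : ℝ) 1) :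
    HasSum (fun n : ℤ => ‖osc v (node b n) x‖ ^ 2)
      (∫ t, ‖(Iic x).indicator (pot v) t‖ ^ 2 ∂unitMeasure) := by
  convert hasSum_parseval b ((memLp_pot v).indicator (measurableSet_Iic (a := x))) using 3 with n
  have hindicator : (fun t => (Iic x).indicator (pot v) t * planeWave (-2 * node b n) t) =
      (Iic x).indicator (fun t => pot v t * planeWave (-2 * node b n) t) :=
    funext fun t => (indicator_mul_left (Iic x) (pot v) (planeWave (-2 * node b n))).symm
  rw [osc, primitive_apply, clamp_of_mem hx, hindicator, integral_indicator measurableSet_Iic,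
    unitMeasure, restrict_Ioo_eq_restrict_Ioc, Measure.restrict_restrict measurableSet_Iic,
    Iic_inter_Ioc_of_le hx.2, intervalIntegral.integral_of_le hx.1]

theorem sum_norm_osc_sq_le (v : H) (b : ℝ) (s : Finset ℤ) {x : ℝ} (hx : x ∈ Icc (0 : ℝ) 1) :
    ∑ n ∈ s, ‖osc v (node b n) x‖ ^ 2 ≤ ‖v‖ ^ 2 := by
  refine (sum_le_hasSum s (fun _ _ => sq_nonneg _) (hasSum_norm_osc_sq v b hx)).trans ?_
  rw [norm_sq_eq_integral]
  exact integral_mono ((memLp_pot v).indicator measurableSet_Iic).norm.integrable_sq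
    (memLp_pot v).norm.integrable_sq fun t =>
      pow_le_pow_left₀ (norm_nonneg _) (norm_indicator_le_norm_self (pot v) t) 2

theorem summable_oscNorm_sq (v : H) (b : ℝ) :
    Summable (fun n : ℤ => oscNorm v (node b n) ^ 2) := by
  have hint (n : ℤ) : Integrable (fun t => ‖osc v (node b n) t‖ ^ 2) unitMeasure :=
    (memLp_boundedContinuousFunction (osc v (node b n))).norm.integrable_sq
  refine summable_of_sum_le (fun _ => sq_nonneg _) (c := ‖v‖ ^ 2) fun s => ?_
  calc ∑ n ∈ s, oscNorm v (node b n) ^ 2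
      = ∫ t, ∑ n ∈ s, ‖osc v (node b n) t‖ ^ 2 ∂unitMeasure := by
        simp_rw [oscNorm_sq]
        exact (integral_finsetSum s fun n _ => hint n).symm
    _ ≤ ∫ _, ‖v‖ ^ 2 ∂unitMeasure :=
        integral_mono_ae (integrable_finsetSum s fun n _ => hint n) (integrable_const _)
          ((ae_restrict_mem measurableSet_Ioo).mono fun t ht =>
            sum_norm_osc_sq_le v b s (Ioo_subset_Icc_self ht))
    _ = ‖v‖ ^ 2 := by simp

theorem summable_oscSize_sq (v : H) (b : ℝ) :
    Summable (fun n : ℤ => oscSize v (node b n) 1 ^ 2) := by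
  have hosc := (hasSum_norm_osc_sq v b (right_mem_Icc.2 zero_le_one)).summable
  refine ((hosc.add (summable_oscNorm_sq v b)).mul_left 2).of_nonneg_of_le
    (fun _ => sq_nonneg _) fun n => add_sq_le

theorem integral_planeWave (k : ℤ) :
    ∫ t, planeWave (2 * Real.pi * k) t ∂unitMeasure = if k = 0 then 1 else 0 := by
  rcases eq_or_ne k 0 with rfl | hk
  · simp [planeWave_apply]
  have hperiod : planeWave (2 * Real.pi * k) 1 = 1 := by
    rw [planeWave_apply, ← Complex.exp_int_mul_two_pi_mul_I k]
    congr 1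
    push_cast
    ring
  have hftc := (isPrimitive_planeWave (2 * Real.pi * k)).apply_one
  rw [hperiod, planeWave_apply_zero, integral_const_mul, left_eq_add] at hftc
  rw [if_neg hk]
  refine (mul_eq_zero.1 hftc).resolve_left (mul_ne_zero Complex.I_ne_zero ?_)
  exact_mod_cast mul_ne_zero Real.two_pi_pos.ne' (Int.cast_ne_zero.2 hk)

theorem integral_conj_planeWave_node_mul (b : ℝ) (n m : ℤ) :
    ∫ t, conj (planeWave (2 * node b n) t) * planeWave (2 * node b m) t ∂unitMeasure =
      if n = m then 1 else 0 := by
  have hfreq : -(2 * node b n) + 2 * node b m = 2 * Real.pi * ↑(m - n) := by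
    simp only [node]
    push_cast
    ring
  simp only [conj_planeWave, ← planeWave_add, hfreq, integral_planeWave, sub_eq_zero, eq_comm]

/-- The gradients of the eigenvalues and norming constants at `v = 0`. -/
def freeFamily (b : ℝ) : ℤ ⊕ ℤ → H :=
  Sum.elim (fun n => toH (planeWave (2 * node b n)))
    (fun n => -toH (Complex.I • planeWave (2 * node b n)))

theorem inner_toH_eq_re {w : ℝ →ᵇ ℂ} {v : H} :
    inner ℝ (toH w) v = (∫ t, conj (w t) * pot v t ∂unitMeasure).re := by
  have hint : Integrable (fun t => conj (w t) * pot v t) unitMeasure :=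
    (integrable_mul_boundedContinuousFunction (integrable_pot v) (star w)).congr
      (Eventually.of_forall fun t => mul_comm _ _)
  rw [inner_toH]
  exact integral_re hint

theorem inner_neg_toH_I_smul (w : ℝ →ᵇ ℂ) (v : H) :
    inner ℝ (-toH (Complex.I • w)) v = -(∫ t, conj (w t) * pot v t ∂unitMeasure).im := by
  have hsmul (t : ℝ) : conj ((Complex.I • w) t) * pot v t =
      -Complex.I * (conj (w t) * pot v t) := by
    simp [mul_assoc]
  simp only [inner_neg_left, inner_toH_eq_re, hsmul, integral_const_mul]
  simp

theorem integral_conj_mul_pot_toH (w u : ℝ →ᵇ ℂ) :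
    ∫ t, conj (w t) * pot (toH u) t ∂unitMeasure = ∫ t, conj (w t) * u t ∂unitMeasure := by
  refine integral_congr_ae ?_
  filter_upwards [pot_toH u] with t ht
  rw [ht]

theorem orthonormal_freeFamily (b : ℝ) : Orthonormal ℝ (freeFamily b) := by
  have hI (n m : ℤ) :
      ∫ t, conj (planeWave (2 * node b n) t) * (Complex.I • planeWave (2 * node b m)) t
        ∂unitMeasure = Complex.I * if n = m then 1 else 0 := by
    simp only [BoundedContinuousFunction.smul_apply, smul_eq_mul,
      mul_left_comm _ Complex.I, integral_const_mul, integral_conj_planeWave_node_mul]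
  rw [orthonormal_iff_ite]
  rintro (n | n) (m | m) <;>
  simp only [freeFamily, Sum.elim_inl, Sum.elim_inr, inner_neg_right, inner_toH_eq_re,
    inner_neg_toH_I_smul, integral_conj_mul_pot_toH, hI, integral_conj_planeWave_node_mul,
    Sum.inl.injEq, Sum.inr.injEq, reduceCtorEq, if_false] <;>
  split_ifs <;> simp

theorem span_freeFamily_orthogonal (b : ℝ) :
    (Submodule.span ℝ (Set.range (freeFamily b)))ᗮ = ⊥ := by
  rw [Submodule.eq_bot_iff]
  intro v hv
  have hinner (i : ℤ ⊕ ℤ) : inner ℝ (freeFamily b i) v = 0 :=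
    (Submodule.mem_orthogonal _ _).1 hv _ (Submodule.subset_span ⟨i, rfl⟩)
  have hcoeff (n : ℤ) : ∫ t, pot v t * planeWave (-2 * node b n) t ∂unitMeasure = 0 := by
    have hre := hinner (Sum.inl n)
    have him := hinner (Sum.inr n)
    simp only [freeFamily, Sum.elim_inl, Sum.elim_inr, inner_toH_eq_re, inner_neg_toH_I_smul,
      neg_eq_zero, conj_planeWave, ← neg_mul] at hre him
    simp only [mul_comm (pot v _)]
    exact Complex.ext hre him
  have hparseval := hasSum_parseval b (memLp_pot v)
  simp only [hcoeff, norm_zero, zero_pow two_ne_zero, ← norm_sq_eq_integral] at hparseval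
  exact norm_eq_zero.1 (sq_eq_zero_iff.1 (hparseval.unique hasSum_zero))

/-- The `freeFamily` as a Hilbert basis. -/
def freeBasis (b : ℝ) : HilbertBasis (ℤ ⊕ ℤ) ℝ H :=
  HilbertBasis.mkOfOrthogonalEqBot (orthonormal_freeFamily b) (span_freeFamily_orthogonal b)

theorem coe_freeBasis (b : ℝ) : ⇑(freeBasis b) = freeFamily b := by
  simp [freeBasis]

end Fourier

/-! ### Bari's theorem -/

section Bari

open scoped InnerProductSpace lp

theorem eq_zero_of_hasSum_smul {R κ M : Type*} [DecidableEq κ] [Semiring R] [TopologicalSpace R]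
    [T2Space R] [AddCommMonoid M] [TopologicalSpace M] [Module R M] {e : κ → M}
    (φ : κ → M →L[R] R) (hφ : ∀ i j, φ i (e j) = if i = j then 1 else 0) {a : κ → R}
    (ha : HasSum (fun i => a i • e i) 0) : a = 0 := by
  ext i
  have hi : HasSum (fun j => φ i (a j • e j)) (φ i (a i • e i)) :=
    hasSum_single i fun j hj => by simp [hφ, hj.symm]
  simpa [hφ] using hi.unique ((φ i).hasSum ha)

theorem summable_smul_and_norm_tsum_smul_le {𝕜 κ F : Type*} [NormedField 𝕜]
    [NormedAddCommGroup F] [NormedSpace 𝕜 F] [CompleteSpace F] {a : κ → 𝕜} {u : κ → F}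
    (ha : Summable fun i => ‖a i‖ ^ 2) (hu : Summable fun i => ‖u i‖ ^ 2) :
    Summable (fun i => a i • u i) ∧
      ‖∑' i, a i • u i‖ ≤ √(∑' i, ‖a i‖ ^ 2) * √(∑' i, ‖u i‖ ^ 2) := by
  obtain ⟨hs, hle⟩ := Real.summable_and_inner_le_Lp_mul_Lq_tsum_of_nonneg
    Real.HolderConjugate.two_two (fun i => norm_nonneg (a i)) (fun i => norm_nonneg (u i))
    (by simpa only [Real.rpow_two] using ha) (by simpa only [Real.rpow_two] using hu)
  simp only [Real.rpow_two, ← Real.sqrt_eq_rpow] at hle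
  simp only [← norm_smul] at hs hle
  exact ⟨hs.of_norm, (norm_tsum_le_tsum_norm hs).trans hle⟩

variable {𝕜 ι F : Type*} [RCLike 𝕜] [NormedAddCommGroup F] [NormedSpace 𝕜 F] [CompleteSpace F]
  {u : ι → F}

theorem hasSum_norm_sq (a : ℓ²(ι, 𝕜)) : HasSum (fun i => ‖a i‖ ^ 2) (‖a‖ ^ 2) := by
  simpa using lp.hasSum_norm (p := 2) (by norm_num) a

/-- The operator `a ↦ ∑ aᵢ uᵢ` on `ℓ²` attached to a square-summable family `u`. -/
def synthesis (𝕜 : Type*) [RCLike 𝕜] [NormedSpace 𝕜 F] (u : ι → F)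
    (hu : Summable fun i => ‖u i‖ ^ 2) : ℓ²(ι, 𝕜) →L[𝕜] F :=
  have hs (a : ℓ²(ι, 𝕜)) := summable_smul_and_norm_tsum_smul_le (hasSum_norm_sq a).summable hu
  LinearMap.mkContinuous
    { toFun := fun a => ∑' i, a i • u i
      map_add' := fun a b => by
        simp only [lp.coeFn_add, Pi.add_apply, add_smul, (hs a).1.tsum_add (hs b).1]
      map_smul' := fun r a => by
        simp only [lp.coeFn_smul, Pi.smul_apply, smul_eq_mul, mul_smul, RingHom.id_apply,
          (hs a).1.tsum_const_smul] }
    √(∑' i, ‖u i‖ ^ 2) fun a => by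
      have h := (hs a).2
      rwa [(hasSum_norm_sq a).tsum_eq, Real.sqrt_sq (norm_nonneg a), mul_comm] at h

theorem hasSum_synthesis (hu : Summable fun i => ‖u i‖ ^ 2) (a : ℓ²(ι, 𝕜)) :
    HasSum (fun i => a i • u i) (synthesis 𝕜 u hu a) :=
  (summable_smul_and_norm_tsum_smul_le (hasSum_norm_sq a).summable hu).1.hasSum

theorem synthesis_single [DecidableEq ι] (hu : Summable fun i => ‖u i‖ ^ 2) (i : ι) :
    synthesis 𝕜 u hu (lp.single 2 i 1) = u i := by
  refine (hasSum_synthesis hu _).unique ?_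
  simpa using hasSum_single (f := fun j => (lp.single 2 i (1 : 𝕜) : ℓ²(ι, 𝕜)) j • u j) i
    fun j hj => by simp [lp.single_apply, hj]

theorem norm_synthesis_sub_sum_le (hu : Summable fun i => ‖u i‖ ^ 2) (s : Finset ι) :
    ‖synthesis 𝕜 u hu - ∑ i ∈ s, (lp.evalCLM 𝕜 (fun _ : ι => 𝕜) 2 i).smulRight (u i)‖ ≤
      √(∑' i : {i // i ∉ s}, ‖u i‖ ^ 2) := by
  refine ContinuousLinearMap.opNorm_le_bound _ (Real.sqrt_nonneg _) fun a => ?_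
  have ha := hasSum_norm_sq a
  have htail : (synthesis 𝕜 u hu - ∑ i ∈ s, (lp.evalCLM 𝕜 (fun _ : ι => 𝕜) 2 i).smulRight (u i)) a
      = ∑' i : {i // i ∉ s}, a i • u i := by
    have h := hasSum_synthesis hu a
    have hsum : (∑ i ∈ s, (lp.evalCLM 𝕜 (fun _ : ι => 𝕜) 2 i).smulRight (u i)) a =
        ∑ i ∈ s, a i • u i := sum_apply ..
    rw [sub_apply, hsum, ← h.tsum_eq, ← h.summable.sum_add_tsum_subtype_compl s]
    exact add_sub_cancel_left _ _
  have hle : ∑' i : {i // i ∉ s}, ‖a i‖ ^ 2 ≤ ‖a‖ ^ 2 :=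
    ha.tsum_eq ▸ ha.summable.tsum_subtype_le _ {i | i ∉ s} fun i => sq_nonneg _
  rw [htail, mul_comm]
  refine (summable_smul_and_norm_tsum_smul_le (ha.summable.subtype {i | i ∉ s})
    (hu.subtype {i | i ∉ s})).2.trans ?_
  exact mul_le_mul_of_nonneg_right (Real.sqrt_le_iff.2 ⟨norm_nonneg a, hle⟩) (Real.sqrt_nonneg _)

theorem isCompactOperator_synthesis (hu : Summable fun i => ‖u i‖ ^ 2) :
    IsCompactOperator (synthesis 𝕜 u hu) := by
  have htail : Tendsto (fun s : Finset ι => √(∑' i : {i // i ∉ s}, ‖u i‖ ^ 2)) atTop (𝓝 0) := by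
    simpa using (tendsto_tsum_compl_atTop_zero fun i => ‖u i‖ ^ 2).sqrt
  have hlim : Tendsto
      (fun s => ∑ i ∈ s, (lp.evalCLM 𝕜 (fun _ : ι => 𝕜) 2 i).smulRight (u i)) atTop
      (𝓝 (synthesis 𝕜 u hu)) := by
    refine tendsto_iff_norm_sub_tendsto_zero.2 (squeeze_zero (fun _ => norm_nonneg _)
      (fun s => ?_) htail)
    rw [norm_sub_rev]
    exact norm_synthesis_sub_sum_le hu s
  refine isCompactOperator_of_tendsto hlim (Eventually.of_forall fun s => ?_)
  refine (compactOperator (RingHom.id 𝕜) ℓ²(ι, 𝕜) F).sum_mem fun i _ => ?_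
  exact (isCompactOperator_of_locallyCompactSpace_dom
    (lp.evalCLM 𝕜 (fun _ : ι => 𝕜) 2 i)).clm_comp (ContinuousLinearMap.toSpanSingleton 𝕜 (u i))

variable {E : Type*} [NormedAddCommGroup E] [InnerProductSpace 𝕜 E] [CompleteSpace E]
  [DecidableEq ι]

-- With `S bᵢ = eᵢ - bᵢ`, the operator `1 + S` maps `bᵢ` to `eᵢ`; as `S` is compact, the Fredholm
-- alternative makes `1 + S` invertible as soon as it is injective.
theorem exists_equiv_of_summable_norm_sub_sq (b : HilbertBasis ι 𝕜 E) {e : ι → E}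
    (hs : Summable fun i => ‖e i - b i‖ ^ 2)
    (hinj : ∀ a : ℓ²(ι, 𝕜), HasSum (fun i => a i • e i) 0 → a = 0) :
    ∃ T : ℓ²(ι, 𝕜) ≃L[𝕜] E, ∀ i, T (lp.single 2 i (1 : 𝕜)) = e i := by
  obtain ⟨S, hcompact, hS⟩ : ∃ S : E →L[𝕜] E, IsCompactOperator S ∧
      ∀ x, S x = synthesis 𝕜 (fun i => e i - b i) hs (b.repr x) :=
    ⟨(synthesis 𝕜 _ hs).comp b.repr.toContinuousLinearEquiv.toContinuousLinearMap,
      IsCompactOperator.comp_clm (isCompactOperator_synthesis (𝕜 := 𝕜) hs)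
        b.repr.toContinuousLinearEquiv.toContinuousLinearMap,
      fun _ => rfl⟩
  have hsum (x : E) : HasSum (fun i => b.repr x i • e i) (x + S x) := by
    have h := (b.hasSum_repr x).add (hasSum_synthesis hs (b.repr x))
    simpa only [← smul_add, add_sub_cancel, hS] using h
  have hunit : IsUnit (1 + S) := by
    have hneg : IsCompactOperator (-S) := hcompact.neg
    rcases hneg.hasEigenvalue_or_mem_resolventSet one_ne_zero with h | h
    · obtain ⟨x, hx⟩ := h.exists_hasEigenvector
      have hx0 : x + S x = 0 := by
        simpa [neg_eq_iff_add_eq_zero, add_comm] using hx.apply_eq_smul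
      exact absurd (b.repr.map_eq_zero_iff.1 (hinj _ (hx0 ▸ hsum x))) hx.2
    · simpa [spectrum.mem_resolventSet_iff] using h
  obtain ⟨U, hU⟩ := hunit
  refine ⟨b.repr.symm.toContinuousLinearEquiv.trans (ContinuousLinearEquiv.ofUnit U), fun i => ?_⟩
  have hUi : U.1 (b i) = e i := by
    rw [hU, add_apply, hS, b.repr_self, synthesis_single, one_apply_eq_self, add_sub_cancel]
  simpa using! hUi

end Bari

/-! ### Labelling of the eigenvalues -/

section Labelling

theorem orderIso_int_apply (σ : ℤ ≃o ℤ) (n : ℤ) : σ n = n + σ 0 := by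
  have hs (m : ℤ) : σ (m + 1) = σ m + 1 := σ.map_succ m
  induction n using Int.induction_on with
  | zero => simp
  | succ k ih => rw [hs, ih]; ring
  | pred k ih =>
    have h := hs (-(k : ℤ) - 1)
    rw [sub_add_cancel, ih] at h
    linarith

theorem exists_eq_comp_add_of_range_eq {α : Type*} [LinearOrder α] {s s' : ℤ → α}
    (hs : StrictMono s) (hs' : StrictMono s') (hrange : range s = range s') :
    ∃ k : ℤ, ∀ n, s' n = s (n + k) := by
  let σ : ℤ ≃o ℤ := ((hs'.orderIso s').trans (OrderIso.setCongr _ _ hrange.symm)).trans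
    (hs.orderIso s).symm
  refine ⟨σ 0, fun n => ?_⟩
  rw [← orderIso_int_apply σ n]
  exact (congrArg Subtype.val ((hs.orderIso s).apply_symm_apply
    (OrderIso.setCongr _ _ hrange.symm (hs'.orderIso s' n)))).symm

theorem IsLabelling.unique {S : Set ℂ} {c s s' : ℤ → ℝ} {d : ℝ} (hd : d ≠ 0)
    (hc : ∀ n k : ℤ, c (n + k) = c n + d * k) (h : IsLabelling S c s) (h' : IsLabelling S c s') :
    s = s' := by
  obtain ⟨hmono, hrange, hlim⟩ := h
  obtain ⟨hmono', hrange', hlim'⟩ := h'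
  have himage (q : ℤ → ℝ) : range (fun n => (q n : ℂ)) = Complex.ofReal '' range q :=
    range_comp Complex.ofReal q
  rw [himage] at hrange hrange'
  obtain ⟨k, hk⟩ := exists_eq_comp_add_of_range_eq hmono hmono'
    (Complex.ofReal_injective.image_injective (hrange.trans hrange'.symm))
  have hdiff : Tendsto (fun _ : ℤ => d * k) cofinite (𝓝 0) := by
    have hshift := hlim'.sub (hlim.comp (add_left_injective k).tendsto_cofinite)
    rw [sub_zero] at hshift
    refine hshift.congr fun n => ?_
    simp only [Function.comp_apply, hk, hc]
    ring
  have hk0 : k = 0 := by simpa [tendsto_const_nhds_iff, hd] using hdiff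
  ext n
  rw [hk, hk0, add_zero]

theorem strictMono_node (b : ℝ) : StrictMono (node b) := fun n m h => by
  simp only [node]
  gcongr

theorem node_add (b : ℝ) (n k : ℤ) : node b (n + k) = node b n + Real.pi * k := by
  simp only [node]
  push_cast
  ring

theorem sin_add_eq_zero_iff {a b : ℝ} : Real.sin (a + b) = 0 ↔ ∃ n : ℤ, a = node b n := by
  rw [Real.sin_eq_zero_iff]
  exact exists_congr fun n => by rw [node, eq_sub_iff_add_eq, eq_comm, mul_comm]

theorem sin_node_sub_node (b : ℝ) (n m : ℤ) : Real.sin (node b m - node b n) = 0 := by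
  have h : node b m - node b n = ((m - n : ℤ) : ℝ) * Real.pi := by
    simp only [node]
    push_cast
    ring
  rw [h, Real.sin_int_mul_pi]

theorem strictMono_level (v : H) : StrictMono fun c => level c v := fun c c' h => by
  rwa [← (strictMono_angle v).lt_iff_lt, angle_level, angle_level]

theorem tendsto_oscSize_node (v : H) (b : ℝ) :
    Tendsto (fun n : ℤ => oscSize v (node b n) 1) cofinite (𝓝 0) := by
  simpa [Real.sqrt_sq (oscSize_nonneg _ _ _)] using
    (summable_oscSize_sq v b).tendsto_cofinite_zero.sqrt

theorem isLabelling_level (v : H) (b : ℝ) :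
    IsLabelling (Complex.ofReal '' {r | Real.sin (angle (v, r) + b) = 0}) (node b)
      (fun n => level (node b n) v) := by
  refine ⟨(strictMono_level v).comp (strictMono_node b), ?_, ?_⟩
  · have hrange : range (fun n => level (node b n) v) =
        {r | Real.sin (angle (v, r) + b) = 0} := by
      ext r
      rw [mem_ofPred_eq, sin_add_eq_zero_iff]
      exact ⟨fun ⟨n, hn⟩ => ⟨n, hn ▸ angle_level _ v⟩, fun ⟨n, hn⟩ => ⟨n, (eq_level hn).symm⟩⟩
    rw [← hrange]
    exact range_comp Complex.ofReal _
  · obtain ⟨K, -, hK⟩ := exists_abs_level_sub_le v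
    refine squeeze_zero_norm (fun n => hK (node b n)) ?_
    simpa using (tendsto_oscSize_node v b).const_mul K

theorem sol_one_im (p : H × ℝ) :
    (sol 1 p 1).im = ‖sol 1 p 1‖ * Real.sin (angle p + 0) := by
  conv_lhs => rw [sol_one_apply_one, Complex.im_ofReal_mul, Complex.exp_ofReal_mul_I_im]
  rw [add_zero]

theorem sol_one_re (p : H × ℝ) :
    (sol 1 p 1).re = ‖sol 1 p 1‖ * Real.sin (angle p + Real.pi / 2) := by
  conv_lhs => rw [sol_one_apply_one, Complex.re_ofReal_mul, Complex.exp_ofReal_mul_I_re]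
  rw [Real.sin_add_pi_div_two]

theorem eigenvalues_one_one (v : H) :
    eigenvalues v 1 1 = Complex.ofReal '' {r | Real.sin (angle (v, r) + 0) = 0} := by
  rw [eigenvalues_one_left]
  simp only [realPair, Matrix.cons_val_one, Matrix.cons_val_fin_one, Complex.ofReal_eq_zero,
    sol_one_im, mul_eq_zero, norm_eq_zero, sol_one_ne_zero, false_or]

theorem eigenvalues_one_zero (v : H) :
    eigenvalues v 1 0 = Complex.ofReal '' {r | Real.sin (angle (v, r) + Real.pi / 2) = 0} := by
  rw [eigenvalues_one_left]
  simp only [realPair, Matrix.cons_val_zero, Complex.ofReal_eq_zero, sol_one_re, mul_eq_zero,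
    norm_eq_zero, sol_one_ne_zero, false_or]

theorem node_zero : node 0 = fun m : ℤ => Real.pi * (m : ℝ) := by
  ext m
  rw [node, sub_zero]

theorem node_half_pi : node (Real.pi / 2) = fun m : ℤ => Real.pi * ((m : ℝ) - 1 / 2) := by
  ext m
  rw [node]
  ring

theorem IsLabelling.epsilon_eq {S : Set ℂ} {b : ℝ} {s : ℤ → ℝ} (h : IsLabelling S (node b) s) :
    Classical.epsilon (IsLabelling S (node b)) = s :=
  IsLabelling.unique Real.pi_ne_zero (node_add b) (Classical.epsilon_spec ⟨s, h⟩) h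

theorem nu_eq_level (n : ℤ) : nu n = level (node 0 n) := by
  ext v
  rw [nu, ← node_zero, eigenvalues_one_one, (isLabelling_level v 0).epsilon_eq]

theorem rho_eq_level (n : ℤ) : rho n = level (node (Real.pi / 2) n) := by
  ext v
  rw [rho, ← node_half_pi, eigenvalues_one_zero, (isLabelling_level v _).epsilon_eq]

theorem tau_eq_rho_neg (n : ℤ) (v : H) : tau n v = rho n (-v) :=
  congrArg (fun S => Classical.epsilon (IsLabelling S _) n) (eigenvalues_neg v 0 1).symm

theorem isLabelling_nu (v : H) :
    IsLabelling (eigenvalues v 1 1) (fun m => Real.pi * m) (fun n => nu n v) := by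
  simpa only [nu_eq_level, ← node_zero, eigenvalues_one_one] using isLabelling_level v 0

theorem isLabelling_rho (v : H) :
    IsLabelling (eigenvalues v 1 0) (fun m => Real.pi * (m - 1 / 2)) (fun n => rho n v) := by
  simpa only [rho_eq_level, ← node_half_pi, eigenvalues_one_zero] using isLabelling_level v _

theorem isLabelling_tau (v : H) :
    IsLabelling (eigenvalues v 0 1) (fun m => Real.pi * (m - 1 / 2)) (fun n => tau n v) := by
  simp only [tau_eq_rho_neg, ← eigenvalues_neg v 0 1]
  exact isLabelling_rho (-v)

theorem normS_eq_norming (n : ℤ) : normS n = norming (node 0 n) := by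
  ext v
  have him : (sol 1 (v, level (node 0 n) v) 1).im = 0 := by
    rw [sol_one_im, angle_level, sin_add_eq_zero_iff.2 ⟨n, rfl⟩, mul_zero]
  rw [normS, norming, nu_eq_level, theta_one, ← Complex.abs_re_eq_norm.2 him]
  simp [realPair]

theorem normU_eq_norming (n : ℤ) : normU n = norming (node (Real.pi / 2) n) := by
  ext v
  have hre : (sol 1 (v, level (node (Real.pi / 2) n) v) 1).re = 0 := by
    rw [sol_one_re, angle_level, sin_add_eq_zero_iff.2 ⟨n, rfl⟩, mul_zero]
  rw [normU, norming, rho_eq_level, theta_one, ← Complex.abs_im_eq_norm.2 hre]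
  simp [realPair]

theorem normT_eq_normU_neg (n : ℤ) (v : H) : normT n v = normU n (-v) := by
  rw [normT, normU, tau_eq_rho_neg, phi_one_zero, norm_neg]

end Labelling

/-! ### Gradients of the spectral data -/

section SpectralData

theorem hasGradientAt_nu (n : ℤ) (v : H) : HasGradientAt (nu n) (levelGrad (node 0 n) v) v :=
  nu_eq_level n ▸ hasGradientAt_level _ v

theorem hasGradientAt_normS (n : ℤ) (v : H) :
    HasGradientAt (normS n) (normingGrad (node 0 n) v) v :=
  normS_eq_norming n ▸ hasGradientAt_norming _ v

theorem hasGradientAt_rho (n : ℤ) (v : H) :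
    HasGradientAt (rho n) (levelGrad (node (Real.pi / 2) n) v) v :=
  rho_eq_level n ▸ hasGradientAt_level _ v

theorem hasGradientAt_normU (n : ℤ) (v : H) :
    HasGradientAt (normU n) (normingGrad (node (Real.pi / 2) n) v) v :=
  normU_eq_norming n ▸ hasGradientAt_norming _ v

theorem hasGradientAt_comp_neg {E : Type*} [NormedAddCommGroup E] [InnerProductSpace ℝ E]
    [CompleteSpace E] {f : E → ℝ} {g v : E} (h : HasGradientAt f g (-v)) :
    HasGradientAt (fun w => f (-w)) (-g) v := by
  rw [hasGradientAt_iff_hasFDerivAt] at h ⊢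
  refine (h.comp v (hasFDerivAt_id (𝕜 := ℝ) v).neg).congr_fderiv ?_
  ext δ
  simp

theorem hasGradientAt_tau (n : ℤ) (v : H) :
    HasGradientAt (tau n) (-levelGrad (node (Real.pi / 2) n) (-v)) v :=
  funext (tau_eq_rho_neg n) ▸ hasGradientAt_comp_neg (hasGradientAt_rho n (-v))

theorem hasGradientAt_normT (n : ℤ) (v : H) :
    HasGradientAt (normT n) (-normingGrad (node (Real.pi / 2) n) (-v)) v :=
  funext (normT_eq_normU_neg n) ▸ hasGradientAt_comp_neg (hasGradientAt_normU n (-v))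

theorem wedge_neg_neg (f g : H) : wedge (-f) (-g) = wedge f g := by
  rw [← neg_one_smul ℝ f, ← neg_one_smul ℝ g, wedge_smul_left, wedge_smul_right]
  ring

theorem canonical_relations (b : ℝ) (v : H) (n j : ℤ) :
    wedge (levelGrad (node b n) v) (levelGrad (node b j) v) = 0 ∧
      wedge (normingGrad (node b n) v) (levelGrad (node b j) v) = (if n = j then 1 else 0) ∧
      wedge (normingGrad (node b n) v) (normingGrad (node b j) v) = 0 := by
  have hs := sin_node_sub_node b n j
  refine ⟨wedge_levelGrad_levelGrad hs v, ?_, wedge_normingGrad_normingGrad hs v⟩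
  simp only [wedge_normingGrad_levelGrad hs, (strictMono_node b).injective.eq_iff]

/-- The gradients of the eigenvalues `level (node b n)`, followed by those of the norming constants
`norming (node b n)`. -/
def gradFamily (b : ℝ) (v : H) : ℤ ⊕ ℤ → H :=
  Sum.elim (fun n => levelGrad (node b n) v) (fun n => normingGrad (node b n) v)

/-- The functionals `f ↦ 𝔰ₙ' ∧ f` and `f ↦ -νₙ' ∧ f`, biorthogonal to `gradFamily b v`. -/
def dualFamily (b : ℝ) (v : H) : ℤ ⊕ ℤ → H →L[ℝ] ℝ :=
  Sum.elim (fun n => innerSL ℝ (rotH (normingGrad (node b n) v)))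
    (fun n => -innerSL ℝ (rotH (levelGrad (node b n) v)))

theorem dualFamily_gradFamily (b : ℝ) (v : H) (i j : ℤ ⊕ ℤ) :
    dualFamily b v i (gradFamily b v j) = if i = j then 1 else 0 := by
  rcases i with n | n <;> rcases j with m | m <;>
    simp only [dualFamily, gradFamily, Sum.elim_inl, Sum.elim_inr, innerSL_apply_apply,
      neg_apply, ← wedge_eq_inner, Sum.inl.injEq, Sum.inr.injEq, reduceCtorEq,
      if_false, neg_eq_zero]
  · exact (canonical_relations b v n m).2.1
  · exact (canonical_relations b v n m).2.2
  · exact (canonical_relations b v n m).1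
  · rw [← wedge_antisymm, (canonical_relations b v m n).2.1]
    exact if_congr eq_comm rfl rfl

theorem summable_norm_gradFamily_sub_sq (b : ℝ) (v : H) :
    Summable fun i => ‖gradFamily b v i - freeFamily b i‖ ^ 2 := by
  have hle {g : ℤ → H} {K : ℝ} (h : ∀ n, ‖g n‖ ≤ K * oscSize v (node b n) 1) :
      Summable fun n => ‖g n‖ ^ 2 := by
    refine ((summable_oscSize_sq v b).mul_left (K ^ 2)).of_nonneg_of_le (fun _ => sq_nonneg _)
      fun n => ?_
    rw [← mul_pow]
    gcongr
    exact h n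
  obtain ⟨K, -, hK⟩ := exists_norm_levelGrad_sub_le v
  obtain ⟨L, -, hL⟩ := exists_norm_normingGrad_sub_le v
  exact Summable.sum _ (hle fun n => hK (node b n)) (hle fun n => hL (node b n))

theorem isBasis_gradFamily (b : ℝ) (v : H) : IsBasis (gradFamily b v) := by
  refine exists_equiv_of_summable_norm_sub_sq (freeBasis b) ?_ fun a ha => ?_
  · simpa only [coe_freeBasis] using summable_norm_gradFamily_sub_sq b v
  · exact lp.ext (eq_zero_of_hasSum_smul (dualFamily b v) (dualFamily_gradFamily b v) ha)

theorem IsBasis.neg {ι : Type} [DecidableEq ι] {e : ι → H} (h : IsBasis e) : IsBasis (-e) := by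
  obtain ⟨T, hT⟩ := h
  exact ⟨T.trans (ContinuousLinearEquiv.neg ℝ), fun i => by simp [hT]⟩

theorem isBasis_neg_gradFamily (b : ℝ) (v : H) :
    IsBasis (Sum.elim (fun n => -levelGrad (node b n) v) (fun n => -normingGrad (node b n) v)) := by
  have h := (isBasis_gradFamily b v).neg
  rwa [gradFamily, ← Sum.elim_neg_neg] at h

end SpectralData

end ZS

end

theorem theorem4p8 (v : ZS.H) :
    -- the eigenvalues exist, with their labelling
    (ZS.IsLabelling (ZS.eigenvalues v 1 1) (fun m => Real.pi * m) (fun n => ZS.nu n v) ∧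
      ZS.IsLabelling (ZS.eigenvalues v 0 1) (fun m => Real.pi * (m - 1 / 2))
        (fun n => ZS.tau n v) ∧
      ZS.IsLabelling (ZS.eigenvalues v 1 0) (fun m => Real.pi * (m - 1 / 2))
        (fun n => ZS.rho n v)) ∧
    -- the gradients exist
    (∀ n : ℤ,
      DifferentiableAt ℝ (ZS.nu n) v ∧ DifferentiableAt ℝ (ZS.normS n) v ∧
      DifferentiableAt ℝ (ZS.tau n) v ∧ DifferentiableAt ℝ (ZS.normT n) v ∧
      DifferentiableAt ℝ (ZS.rho n) v ∧ DifferentiableAt ℝ (ZS.normU n) v) ∧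
    -- the canonical relations
    (∀ n j : ℤ,
      (ZS.wedge (gradient (ZS.nu n) v) (gradient (ZS.nu j) v) = 0 ∧
        ZS.wedge (gradient (ZS.normS n) v) (gradient (ZS.nu j) v) = (if n = j then 1 else 0) ∧
        ZS.wedge (gradient (ZS.normS n) v) (gradient (ZS.normS j) v) = 0) ∧
      (ZS.wedge (gradient (ZS.tau n) v) (gradient (ZS.tau j) v) = 0 ∧
        ZS.wedge (gradient (ZS.normT n) v) (gradient (ZS.tau j) v) = (if n = j then 1 else 0) ∧
        ZS.wedge (gradient (ZS.normT n) v) (gradient (ZS.normT j) v) = 0) ∧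
      (ZS.wedge (gradient (ZS.rho n) v) (gradient (ZS.rho j) v) = 0 ∧
        ZS.wedge (gradient (ZS.normU n) v) (gradient (ZS.rho j) v) = (if n = j then 1 else 0) ∧
        ZS.wedge (gradient (ZS.normU n) v) (gradient (ZS.normU j) v) = 0)) ∧
    -- the bases
    ZS.IsBasis (Sum.elim (fun n : ℤ => gradient (ZS.nu n) v)
      (fun n : ℤ => gradient (ZS.normS n) v)) ∧
    ZS.IsBasis (Sum.elim (fun n : ℤ => gradient (ZS.tau n) v)
      (fun n : ℤ => gradient (ZS.normT n) v)) ∧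
    ZS.IsBasis (Sum.elim (fun n : ℤ => gradient (ZS.rho n) v)
      (fun n : ℤ => gradient (ZS.normU n) v)) := by
  refine ⟨⟨ZS.isLabelling_nu v, ZS.isLabelling_tau v, ZS.isLabelling_rho v⟩,
    fun n => ⟨(ZS.hasGradientAt_nu n v).differentiableAt,
      (ZS.hasGradientAt_normS n v).differentiableAt, (ZS.hasGradientAt_tau n v).differentiableAt,
      (ZS.hasGradientAt_normT n v).differentiableAt, (ZS.hasGradientAt_rho n v).differentiableAt,
      (ZS.hasGradientAt_normU n v).differentiableAt⟩, ?_⟩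
  simp only [(ZS.hasGradientAt_nu _ v).gradient, (ZS.hasGradientAt_normS _ v).gradient,
    (ZS.hasGradientAt_tau _ v).gradient, (ZS.hasGradientAt_normT _ v).gradient,
    (ZS.hasGradientAt_rho _ v).gradient, (ZS.hasGradientAt_normU _ v).gradient, ZS.wedge_neg_neg]
  exact ⟨fun n j => ⟨ZS.canonical_relations 0 v n j, ZS.canonical_relations _ (-v) n j,
      ZS.canonical_relations _ v n j⟩,
    ZS.isBasis_gradFamily 0 v, ZS.isBasis_neg_gradFamily _ (-v), ZS.isBasis_gradFamily _ v⟩
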